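/- Let $n\ge 1$ and $s\in\mathbb{R}$. With $\widehat f(\xi)=(2\pi)^{-n/2}\int_{\mathbb{R}^n}e^{-i\langle x,\xi\rangle}f(x)\,dx$ (extended unitarily to $L^2$), put $$\|f\|_{H^s}=\Big(\int_{\mathbb{R}^n}(1+|\xi|^2)^s|\widehat f(\xi)|^2\,d\xi\Big)^{1/2},\qquad e^{it\Delta}f(x)=(2\pi)^{-n/2}\int_{\mathbb{R}^n}e^{i(\langle x,\xi\rangle+t|\xi|^2)}\widehat f(\xi)\,d\xi$$ for Schwartz $f$; for $f\in L^2(\mathbb{R}^n)$, let $e^{it\Delta}f\in L^2(\mathbb{R}^n)$ be the function with Fourier transform $e^{it|\xi|^2}\widehat f(\xi)$. Consider the following two properties. (A) For every $f\in L^2(\mathbb{R}^n)$ with $\|f\|_{H^s}<\infty$ (for $s\ge0$: every $f\in H^s(\mathbb{R}^n)$), $e^{it\Delta}f(x)\to f(x)$ as $t\to0^+$ for a.e. $x\in\mathbb{R}^n$; that is, there is a function $u(x,t)$ such that $u(\cdot,t)=e^{it\Delta}f$ a.e. for each $0<t<1$, and $\lim_{t\to0^+}u(x,t)=f(x)$ for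 a.e. $x$. (B) The Schrödinger maximal operator is bounded from $H^s(\mathbb{R}^n)$ to $L^{2,\infty}(B(0,1))$: there is a constant $C<\infty$ such that for all Schwartz functions $f$ on $\mathbb{R}^n$, $$\sup_{r>0}\, r\,\Big|\Big\{x\in B(0,1):\ \sup_{0<t<1}|e^{it\Delta}f(x)|>r\Big\}\Big|^{1/2}\le C\,\|f\|_{H^s}.$$ Then (A) and (B) are equivalent, and each of them implies $$s\ \ge\ \frac{n}{2(n+1)}.$$ -/

import Mathlib

open MeasureTheory Filter Topology FourierTransform
open scoped ENNReal NNReal SchwartzMap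

noncomputable section

namespace SchrodingerMaximal

/-- The Fourier symbol of `e^{itΔ}` (the propagator of `i ∂ₜ u - Δ u = 0`). Mathlib's Fourier
transform is `𝓕 f ξ = ∫ e^{-2πi⟨x,ξ⟩} f(x) dx`, so the angular frequency is `2πξ` and the symbol
is `e^{it|2πξ|²}`. -/
def symbol {n : ℕ} (t : ℝ) (ξ : EuclideanSpace ℝ (Fin n)) : ℂ :=
  Complex.exp (Complex.I * ((t * (2 * Real.pi * ‖ξ‖) ^ 2 : ℝ) : ℂ))

/-- The Schrödinger solution at time `t` and point `x` for Schwartz initial data: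
`e^{itΔ} f(x) = ∫ e^{i(⟨x, 2πξ⟩ + t|2πξ|²)} 𝓕 f(ξ) dξ`. With the angular frequency `η = 2πξ` and
the unitary normalization of the Fourier transform this is
`(2π)^{-n/2} ∫ e^{i(⟨x, η⟩ + t|η|²)} f^(η) dη`. -/
def evolution {n : ℕ} (t : ℝ) (f : 𝓢(EuclideanSpace ℝ (Fin n), ℂ))
    (x : EuclideanSpace ℝ (Fin n)) : ℂ :=
  ∫ ξ : EuclideanSpace ℝ (Fin n),
    Complex.exp (Complex.I * ((2 * Real.pi * inner ℝ x ξ : ℝ) : ℂ)) * symbol t ξ * 𝓕 f ξ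

lemma norm_symbol {n : ℕ} (t : ℝ) (ξ : EuclideanSpace ℝ (Fin n)) : ‖symbol t ξ‖ = 1 := by
  rw [symbol, mul_comm]
  exact Complex.norm_exp_ofReal_mul_I _

lemma continuous_symbol {n : ℕ} (t : ℝ) :
    Continuous (symbol t : EuclideanSpace ℝ (Fin n) → ℂ) := by
  unfold symbol
  fun_prop

lemma memLp_symbol_mul {n : ℕ} (t : ℝ) (g : Lp (α := EuclideanSpace ℝ (Fin n)) ℂ 2) :
    MemLp (fun ξ => symbol t ξ * g ξ) 2 := by
  refine (Lp.memLp g).of_le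
    ((continuous_symbol t).aestronglyMeasurable.mul (Lp.aestronglyMeasurable g))
    (Eventually.of_forall fun ξ => ?_)
  rw [norm_mul, norm_symbol, one_mul]

/-- `e^{itΔ} f` for `f ∈ L²(ℝⁿ)`, as an element of `L²(ℝⁿ)`: the function whose (Plancherel) Fourier
transform is `e^{it|2πξ|²} 𝓕 f(ξ)`. -/
def evolutionL2 {n : ℕ} (t : ℝ) (f : Lp (α := EuclideanSpace ℝ (Fin n)) ℂ 2) :
    Lp (α := EuclideanSpace ℝ (Fin n)) ℂ 2 :=
  𝓕⁻ ((memLp_symbol_mul t (𝓕 f)).toLp)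

/-- The Sobolev norm `‖f‖_{H^s} = (∫ (1 + |2πξ|²)^s |𝓕 f(ξ)|² dξ)^{1/2}`, possibly infinite. -/
def sobolevNorm {n : ℕ} (s : ℝ) (f : Lp (α := EuclideanSpace ℝ (Fin n)) ℂ 2) : ℝ≥0∞ :=
  (∫⁻ ξ : EuclideanSpace ℝ (Fin n),
    ENNReal.ofReal ((1 + (2 * Real.pi * ‖ξ‖) ^ 2) ^ s) * ‖(𝓕 f) ξ‖ₑ ^ 2) ^ (1 / 2 : ℝ)

/-- The Schrödinger maximal function `x ↦ sup_{0 < t < 1} |e^{itΔ} f(x)|`. -/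
def maximalFunction {n : ℕ} (f : 𝓢(EuclideanSpace ℝ (Fin n), ℂ))
    (x : EuclideanSpace ℝ (Fin n)) : ℝ≥0∞ :=
  ⨆ t ∈ Set.Ioo (0 : ℝ) 1, ‖evolution t f x‖ₑ

/-- The weak `L²` (quasi-)norm `‖g‖_{L^{2,∞}(μ)} = sup_{r ≥ 0} r μ{g > r}^{1/2}`. -/
def weakL2Norm {α : Type*} [MeasurableSpace α] (g : α → ℝ≥0∞) (μ : Measure α) : ℝ≥0∞ :=
  ⨆ r : ℝ≥0, (r : ℝ≥0∞) * μ {x | (r : ℝ≥0∞) < g x} ^ (1 / 2 : ℝ)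

/-- The maximal operator is bounded from `H^s(ℝⁿ)` to `L^{2,∞}(B(0,1))`: the estimate holds with a
uniform constant on the dense class of Schwartz functions. -/
def MaximalBounded (n : ℕ) (s : ℝ) : Prop :=
  ∃ C : ℝ≥0, ∀ f : 𝓢(EuclideanSpace ℝ (Fin n), ℂ),
    weakL2Norm (maximalFunction f) (volume.restrict (Metric.ball 0 1)) ≤
      C * sobolevNorm s (f.toLp 2)

/-- `e^{itΔ} f(x) → f(x)` as `t → 0⁺`, for almost every `x`. For each `t` the function `e^{itΔ} f`
is only an `L²` class, so the statement is about a choice `u(·, t)` of representatives. -/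
def ConvergesAE {n : ℕ} (f : Lp (α := EuclideanSpace ℝ (Fin n)) ℂ 2) : Prop :=
  ∃ u : EuclideanSpace ℝ (Fin n) → ℝ → ℂ,
    (∀ t ∈ Set.Ioo (0 : ℝ) 1, (fun x => u x t) =ᵐ[volume] evolutionL2 t f) ∧
    ∀ᵐ x, Tendsto (u x) (𝓝[>] 0) (𝓝 (f x))

/-- Almost everywhere convergence to the initial data for every `f ∈ L²` with finite `H^s` norm;
for `s ≥ 0` this is every `f ∈ H^s(ℝⁿ)`. -/
def ConvergesAEOnSobolev (n : ℕ) (s : ℝ) : Prop :=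
  ∀ f : Lp (α := EuclideanSpace ℝ (Fin n)) ℂ 2, sobolevNorm s f < ∞ → ConvergesAE f

end SchrodingerMaximal

end

/-!
**Convergence implies the maximal estimate.** Convergence for all of `H^s` yields, by Baire's
theorem applied to the closed sublevel sets of the maximal operator, a weak-type bound in measure
only: outside a set of small measure the maximal function is at most a constant times the norm.
Stein's method upgrades it. If a level set `E` in the unit ball were too large for the `L²` bound,
about `1 / |E|` random translates of `E` would cover a fixed portion of a ball, and a combination
of the corresponding translates of `f` with random signs would have a large maximal function there
while its norm grows only like the square root of the number of translates.

**The maximal estimate implies convergence.** The estimate passes from Schwartz functions to `H^s`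
along rapidly converging Schwartz approximations by Borel–Cantelli, and it spreads from the unit
ball to all of space because the evolution commutes with translations.

**Necessity.** As in Bourgain's example, `f` has for Fourier transform a sum of bumps centred at
`p ^ (2d+2)` lattice frequencies of size about `p ^ (2d+4)` in dimension `d + 1`. For every `x` in
a half ball, simultaneous approximation provides a time of the form `j / D ^ 2` at which all
the phases agree up to a small error modulo `2π`, so the maximal function is there about as large
as the number of bumps. Since `‖f‖_{H^s}` is about `p ^ (d+1) * p ^ ((2d+4)s)`, letting `p → ∞`
gives `d + 1 ≤ (2d + 4) s`.
-/

noncomputable section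

namespace SchrodingerMaximal

/-! ### Random signs -/

section RandomSigns

lemma sum_norm_sq_sum_units_smul {𝕜 H : Type*} [RCLike 𝕜] [SeminormedAddCommGroup H]
    [InnerProductSpace 𝕜 H] {N : ℕ} (h : Fin N → H) :
    ∑ ε : Fin N → ℤˣ, ‖∑ i, ε i • h i‖ ^ 2 = 2 ^ N * ∑ i, ‖h i‖ ^ 2 := by
  induction N with
  | zero => simp
  | succ N ih =>
    have sum_first_sign (ε : Fin N → ℤˣ) :
        ∑ u : ℤˣ, ‖∑ i, Fin.consEquiv (fun _ => ℤˣ) (u, ε) i • h i‖ ^ 2 =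
          2 * ‖h 0‖ ^ 2 + 2 * ‖∑ i, ε i • h i.succ‖ ^ 2 := by
      have parallelogram := parallelogram_law_with_norm 𝕜 (h 0) (∑ i, ε i • h i.succ)
      rw [show (Finset.univ : Finset ℤˣ) = {1, -1} from rfl, Finset.sum_pair (by decide)]
      simp only [Fin.consEquiv_apply, Fin.sum_univ_succ, Fin.cons_zero, Fin.cons_succ, one_smul,
        Units.neg_smul, neg_add_eq_sub, norm_sub_rev _ (h 0)]
      linarith
    rw [← (Fin.consEquiv fun _ => ℤˣ).sum_comp, Fintype.sum_prod_type_right,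
      Finset.sum_congr rfl fun ε _ => sum_first_sign ε, Finset.sum_add_distrib,
      ← Finset.mul_sum Finset.univ (fun ε : Fin N → ℤˣ => ‖∑ i, ε i • h i.succ‖ ^ 2) 2, ih,
      Fin.sum_univ_succ]
    simp only [Finset.sum_const, Finset.card_univ, Fintype.card_pi, Fintype.card_units_int,
      Finset.prod_const, Fintype.card_fin, nsmul_eq_mul, Nat.cast_pow, Nat.cast_ofNat]
    ring

lemma card_le_two_mul_card_filter_of_injective {α : Type*} [Fintype α] {P : α → Prop}
    [DecidablePred P] {σ : α → α} (hσ : Function.Injective σ) (hP : ∀ a, ¬ P a → P (σ a)) :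
    Fintype.card α ≤ 2 * (Finset.univ.filter P).card := by
  have hle : (Finset.univ.filter fun a => ¬ P a).card ≤ (Finset.univ.filter P).card :=
    Finset.card_le_card_of_injOn σ (fun a ha => by simpa using hP a (by simpa using ha)) hσ.injOn
  have hadd := Finset.card_filter_add_card_filter_not (s := Finset.univ) P
  rw [Finset.card_univ] at hadd
  omega

end RandomSigns

/-! ### Covering by translates -/

section Translates

variable {G : Type*} [AddCommGroup G] [MeasurableSpace G] {μ : Measure G} {F U K B : Set G}

lemma measurableSet_iUnion_preimage_sub [MeasurableSub G] {ι : Type*} [Countable ι]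
    (hF : MeasurableSet F) (v : ι → G) : MeasurableSet (⋃ i, (· - v i) ⁻¹' F) :=
  MeasurableSet.iUnion fun i => measurable_id.sub_const (v i) hF

variable [MeasurableAdd G] [MeasurableNeg G] [MeasurableSub₂ G]
  [SFinite μ] [μ.IsAddLeftInvariant] [μ.IsNegInvariant]

lemma lintegral_measure_inter_preimage_sub (hF : MeasurableSet F) (hU : MeasurableSet U) :
    ∫⁻ v, μ (U ∩ (· - v) ⁻¹' F) ∂μ = μ U * μ F := by
  have hS : MeasurableSet {p : G × G | p.1 ∈ U ∧ p.1 - p.2 ∈ F} :=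
    (measurable_fst hU).inter ((measurable_fst.sub measurable_snd) hF)
  have hslice (x : G) :
      μ (Prod.mk x ⁻¹' {p : G × G | p.1 ∈ U ∧ p.1 - p.2 ∈ F}) = U.indicator (fun _ => μ F) x := by
    by_cases hx : x ∈ U
    · have hinv := (μ.measurePreserving_sub_left x).measure_preimage hF.nullMeasurableSet
      simpa [hx, Set.preimage] using hinv
    · simp [hx]
  calc ∫⁻ v, μ (U ∩ (· - v) ⁻¹' F) ∂μ
      = μ.prod μ {p : G × G | p.1 ∈ U ∧ p.1 - p.2 ∈ F} := (Measure.prod_apply_symm hS).symm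
    _ = ∫⁻ x, U.indicator (fun _ => μ F) x ∂μ := by
        rw [Measure.prod_apply hS, lintegral_congr hslice]
    _ = μ U * μ F := by rw [lintegral_indicator_const hU, mul_comm]

lemma exists_translate_measure_inter_ge (hF : MeasurableSet F) (hU : MeasurableSet U)
    (hB : MeasurableSet B) (hUFB : ∀ x ∈ U, ∀ y ∈ F, x - y ∈ B)
    (hB0 : μ B ≠ 0) (hUt : μ U ≠ ∞) (hFt : μ F ≠ ∞) :
    ∃ v, μ U * (μ F / μ B) ≤ μ (U ∩ (· - v) ⁻¹' F) := by
  have hintegral : ∫⁻ v in B, μ (U ∩ (· - v) ⁻¹' F) ∂μ = μ U * μ F := by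
    rw [← lintegral_measure_inter_preimage_sub hF hU, ← lintegral_indicator hB]
    congr with v
    refine Set.indicator_apply_eq_self.2 fun hv => ?_
    convert! measure_empty (μ := μ)
    refine Set.eq_empty_of_forall_notMem fun x hx => hv ?_
    simpa using hUFB x hx.1 (x - v) hx.2
  obtain ⟨v, -, hv⟩ := exists_setLAverage_le hB0 hB.nullMeasurableSet
    (hintegral.trans_ne (ENNReal.mul_ne_top hUt hFt))
  exact ⟨v, by rwa [setLAverage_eq, hintegral, mul_div_assoc] at hv⟩

lemma exists_translates_measure_sdiff_le (hF : MeasurableSet F) (hK : MeasurableSet K)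
    (hB : MeasurableSet B) (hKFB : ∀ x ∈ K, ∀ y ∈ F, x - y ∈ B)
    (hB0 : μ B ≠ 0) (hKt : μ K ≠ ∞) (hFt : μ F ≠ ∞) (N : ℕ) :
    ∃ v : Fin N → G, μ (K \ ⋃ i, (· - v i) ⁻¹' F) ≤ (1 - μ F / μ B) ^ N * μ K := by
  induction N with
  | zero => exact ⟨Fin.elim0, by simp⟩
  | succ N ih =>
    obtain ⟨v, hv⟩ := ih
    set U := K \ ⋃ i, (· - v i) ⁻¹' F with hU
    have hUm : MeasurableSet U := hK.diff (measurableSet_iUnion_preimage_sub hF v)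
    have hUK : U ⊆ K := Set.sdiff_subset
    have hUt : μ U ≠ ∞ := measure_ne_top_of_subset hUK hKt
    obtain ⟨w, hw⟩ := exists_translate_measure_inter_ge hF hUm hB
      (fun x hx => hKFB x (hUK hx)) hB0 hUt hFt
    have hwm : MeasurableSet (U ∩ (· - w) ⁻¹' F) := hUm.inter (measurable_id.sub_const w hF)
    have heq : K \ ⋃ i, (· - (Fin.cons w v : Fin (N + 1) → G) i) ⁻¹' F =
        U \ (U ∩ (· - w) ⁻¹' F) := by
      ext x
      simp only [hU, Set.mem_sdiff, Set.mem_iUnion, Set.mem_preimage, Fin.exists_fin_succ,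
        Fin.cons_zero, Fin.cons_succ, Set.mem_inter_iff]
      tauto
    refine ⟨Fin.cons w v, ?_⟩
    calc μ (K \ ⋃ i, (· - (Fin.cons w v : Fin (N + 1) → G) i) ⁻¹' F)
        = μ U - μ (U ∩ (· - w) ⁻¹' F) := by
          rw [heq, measure_sdiff Set.inter_subset_left hwm.nullMeasurableSet
            (measure_ne_top_of_subset Set.inter_subset_left hUt)]
      _ ≤ μ U - μ U * (μ F / μ B) := tsub_le_tsub_left hw _
      _ = (1 - μ F / μ B) * μ U := by
          rw [mul_comm, ENNReal.sub_mul fun _ _ => hUt, one_mul]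
      _ ≤ (1 - μ F / μ B) * ((1 - μ F / μ B) ^ N * μ K) := by gcongr
      _ = (1 - μ F / μ B) ^ (N + 1) * μ K := by rw [pow_succ', mul_assoc]

lemma one_sub_pow_le_half {p : ℝ≥0∞} {N : ℕ} (hN : 1 ≤ N * p) : (1 - p) ^ N ≤ 2⁻¹ := by
  have hN0 : N ≠ 0 := by
    rintro rfl
    simp at hN
  rcases le_total 1 p with hp | hp
  · simp [tsub_eq_zero_of_le hp, hN0]
  lift p to ℝ≥0 using ne_top_of_le_ne_top ENNReal.one_ne_top hp
  have hN' : (1 : ℝ) ≤ N * p := by exact_mod_cast hN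
  have hp' : (p : ℝ) ≤ 1 := by exact_mod_cast hp
  have hreal : (1 - (p : ℝ)) ^ N * 2 ≤ 1 :=
    calc (1 - (p : ℝ)) ^ N * 2 ≤ (1 - (p : ℝ)) ^ N * (1 + p) ^ N := by
          gcongr
          linarith [one_add_mul_le_pow (by linarith [p.coe_nonneg] : (-2 : ℝ) ≤ p) N]
      _ = (1 - (p : ℝ) ^ 2) ^ N := by rw [← mul_pow]; ring
      _ ≤ 1 := pow_le_one₀ (by nlinarith [p.coe_nonneg]) (by nlinarith [p.coe_nonneg])
  have hnnreal : (1 - p) ^ N * 2 ≤ 1 := by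
    rw [← NNReal.coe_le_coe]
    push_cast [NNReal.coe_sub (show p ≤ 1 from mod_cast hp)]
    exact hreal
  rw [ENNReal.le_inv_iff_mul_le]
  exact_mod_cast hnnreal

lemma exists_translates_cover_half (hF : MeasurableSet F) (hK : MeasurableSet K)
    (hB : MeasurableSet B) (hKFB : ∀ x ∈ K, ∀ y ∈ F, x - y ∈ B)
    (hB0 : μ B ≠ 0) (hBt : μ B ≠ ∞) (hKt : μ K ≠ ∞) (hFt : μ F ≠ ∞) {N : ℕ}
    (hN : μ B ≤ N * μ F) :
    ∃ v : Fin N → G, μ K ≤ 2 * μ (K ∩ ⋃ i, (· - v i) ⁻¹' F) := by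
  obtain ⟨v, hv⟩ := exists_translates_measure_sdiff_le hF hK hB hKFB hB0 hKt hFt N
  refine ⟨v, ?_⟩
  have hp : 1 ≤ N * (μ F / μ B) := by
    rwa [← mul_div_assoc, ENNReal.le_div_iff_mul_le (.inl hB0) (.inl hBt), one_mul]
  have huncovered : μ (K \ ⋃ i, (· - v i) ⁻¹' F) ≤ μ K / 2 := by
    rw [ENNReal.div_eq_inv_mul]
    exact hv.trans (mul_le_mul_left (one_sub_pow_le_half hp) _)
  have hsplit := measure_inter_add_sdiff (μ := μ) K (measurableSet_iUnion_preimage_sub hF v)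
  have hhalf : μ K / 2 ≤ μ (K ∩ ⋃ i, (· - v i) ⁻¹' F) := by
    refine (ENNReal.add_le_add_iff_right (ENNReal.div_ne_top hKt two_ne_zero)).1 ?_
    rw [ENNReal.add_halves]
    exact hsplit.symm.trans_le (by gcongr)
  rwa [ENNReal.div_le_iff two_ne_zero ENNReal.ofNat_ne_top, mul_comm] at hhalf

end Translates

lemma mul_measure_le_mul_sum_measure {α ι : Type*} [MeasurableSpace α] {μ : Measure α} [Fintype ι]
    {S : Set α} {E : ι → Set α} [∀ x, DecidablePred fun i => x ∈ E i]
    (hE : ∀ i, MeasurableSet (E i)) {k m : ℕ}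
    (hk : ∀ x ∈ S, k ≤ m * (Finset.univ.filter fun i => x ∈ E i).card) :
    k * μ S ≤ m * ∑ i, μ (E i) := by
  have hmeas : Measurable fun x => ∑ i, (E i).indicator (1 : α → ℝ≥0∞) x :=
    Finset.measurable_fun_sum _ fun i _ => measurable_one.indicator (hE i)
  calc k * μ S = ∫⁻ _ in S, k ∂μ := (setLIntegral_const _ _).symm
    _ ≤ ∫⁻ x in S, m * ∑ i, (E i).indicator 1 x ∂μ := by
        refine setLIntegral_mono (hmeas.const_mul _) fun x hx => ?_
        simp only [Set.indicator_apply, Pi.one_apply, Finset.sum_boole]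
        exact_mod_cast hk x hx
    _ ≤ ∫⁻ x, m * ∑ i, (E i).indicator 1 x ∂μ := setLIntegral_le_lintegral _ _
    _ = m * ∑ i, μ (E i) := by
        rw [lintegral_const_mul _ hmeas,
          lintegral_finsetSum _ fun i _ => measurable_one.indicator (hE i)]
        simp only [lintegral_indicator_one (hE _)]

/-! ### Stein's maximal principle -/

section Stein

variable {𝕜 V H G : Type*} [RCLike 𝕜] [AddCommGroup V] [Module 𝕜 V] [SeminormedAddCommGroup H]
  [InnerProductSpace 𝕜 H] [MeasurableSpace G]

lemma sum_measureReal_lt_le {Φ : V →ₗ[𝕜] H} {M : V → G → ℝ≥0∞} {μ : Measure G} {K : Set G}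
    (hKt : μ K ≠ ∞) {A : ℝ} (hA : 0 < A)
    (h : ∀ f, ‖Φ f‖ ≤ A → μ.real (K ∩ {x | 1 < M f x}) ≤ μ.real K / 8) {N : ℕ} (g : Fin N → V) :
    ∑ ε : Fin N → ℤˣ, μ.real (K ∩ {x | 1 < M (∑ i, ε i • g i) x}) ≤
      2 ^ N * μ.real K * (1 / 8 + (∑ i, ‖Φ (g i)‖ ^ 2) / A ^ 2) := by
  have chebyshev (f : V) :
      μ.real (K ∩ {x | 1 < M f x}) ≤ μ.real K * (1 / 8 + ‖Φ f‖ ^ 2 / A ^ 2) := by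
    rcases le_or_gt ‖Φ f‖ A with hf | hf
    · refine (h f hf).trans ?_
      rw [div_eq_mul_one_div]
      gcongr
      exact le_add_of_nonneg_right (by positivity)
    · have hone : 1 ≤ ‖Φ f‖ ^ 2 / A ^ 2 := by
        rw [one_le_div (by positivity)]
        gcongr
      exact (measureReal_mono Set.inter_subset_left hKt).trans
        (le_mul_of_one_le_right measureReal_nonneg (by linarith))
  have hΦ (ε : Fin N → ℤˣ) : Φ (∑ i, ε i • g i) = ∑ i, ε i • Φ (g i) := by
    simp only [map_sum, Units.smul_def, map_zsmul]
  calc _ ≤ ∑ ε : Fin N → ℤˣ, μ.real K * (1 / 8 + ‖Φ (∑ i, ε i • g i)‖ ^ 2 / A ^ 2) :=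
        Finset.sum_le_sum fun ε _ => chebyshev _
    _ = μ.real K * (2 ^ N * (1 / 8) +
          (∑ ε : Fin N → ℤˣ, ‖∑ i, ε i • Φ (g i)‖ ^ 2) / A ^ 2) := by
        simp only [hΦ, ← Finset.mul_sum, Finset.sum_add_distrib, ← Finset.sum_div, Finset.sum_const,
          Finset.card_univ, Fintype.card_pi, Fintype.card_units_int, Finset.prod_const,
          Fintype.card_fin, nsmul_eq_mul, Nat.cast_pow, Nat.cast_ofNat, mul_one_div, mul_one]
    _ = _ := by
        rw [sum_norm_sq_sum_units_smul (𝕜 := 𝕜)]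
        ring

variable [AddCommGroup G]

/-- A sublinear operator `M` from a space `V` of data to the nonnegative functions on a group `G`,
commuting with translations. The data are measured by `‖Φ f‖`, where `Φ` maps to a Hilbert space.
Instead of an action of `G` on `V`, only the existence of a translate of each datum is recorded. -/
structure IsSteinMaximal (Φ : V →ₗ[𝕜] H) (M : V → G → ℝ≥0∞) : Prop where
  measurable (f : V) : Measurable (M f)
  sub_le (f g : V) (x : G) : M (f - g) x ≤ M f x + M g x
  smul (c : 𝕜) (f : V) (x : G) : M (c • f) x = ‖c‖ₑ * M f x
  exists_translate (a : G) (f : V) : ∃ g, ‖Φ g‖ = ‖Φ f‖ ∧ ∀ x, M g x = M f (x - a)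

lemma sum_units_smul_sub_sum_update_neg {E : Type*} [AddCommGroup E] {N : ℕ} (g : Fin N → E)
    (ε : Fin N → ℤˣ) (i : Fin N) :
    ∑ j, ε j • g j - ∑ j, Function.update ε i (-ε i) j • g j = (2 : ℕ) • ε i • g i := by
  rw [← Finset.sum_sub_distrib, Finset.sum_eq_single i]
  · rw [Function.update_self, Units.neg_smul, sub_neg_eq_add, two_nsmul]
  · intro j _ hj
    rw [Function.update_of_ne hj, sub_self]
  · simp

namespace IsSteinMaximal

variable {Φ : V →ₗ[𝕜] H} {M : V → G → ℝ≥0∞} {μ : Measure G} {K B : Set G}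

lemma measurableSet_lt (hM : IsSteinMaximal Φ M) (f : V) (r : ℝ≥0∞) :
    MeasurableSet {x | r < M f x} :=
  _root_.measurableSet_lt measurable_const (hM.measurable f)

lemma units_smul (hM : IsSteinMaximal Φ M) (u : ℤˣ) (f : V) (x : G) : M (u • f) x = M f x := by
  rcases Int.units_eq_one_or u with rfl | rfl
  · rw [one_smul]
  · simpa [Units.neg_smul] using hM.smul (-1) f x

lemma two_pow_le_two_mul_card (hM : IsSteinMaximal Φ M) {N : ℕ} (g : Fin N → V) {x : G} {i : Fin N}
    (hi : 1 < M (g i) x) [DecidablePred fun ε : Fin N → ℤˣ => 1 < M (∑ j, ε j • g j) x] :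
    2 ^ N ≤ 2 * (Finset.univ.filter fun ε : Fin N → ℤˣ => 1 < M (∑ j, ε j • g j) x).card := by
  have hcard : Fintype.card (Fin N → ℤˣ) = 2 ^ N := by simp
  have flip_injective :
      Function.Injective fun ε : Fin N → ℤˣ => Function.update ε i (-ε i) := by
    intro ε ε' h
    simpa using congrArg (fun η => Function.update η i (-η i)) h
  rw [← hcard]
  refine card_le_two_mul_card_filter_of_injective flip_injective fun ε hε => ?_
  by_contra hε'
  have hle : 2 * M (g i) x ≤ 2 :=
    calc 2 * M (g i) x = M ((2 : ℕ) • ε i • g i) x := by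
          rw [← Nat.cast_smul_eq_nsmul 𝕜, hM.smul, hM.units_smul, ← ofReal_norm]
          simp
      _ ≤ M (∑ j, ε j • g j) x + M (∑ j, Function.update ε i (-ε i) j • g j) x := by
          rw [← sum_units_smul_sub_sum_update_neg]
          exact hM.sub_le _ _ x
      _ ≤ 1 + 1 := add_le_add (not_lt.1 hε) (not_lt.1 hε')
      _ = 2 := one_add_one_eq_two
  have hle' : 2 * M (g i) x ≤ 2 * 1 := by rwa [mul_one]
  exact hi.not_ge ((ENNReal.mul_le_mul_iff_right two_ne_zero ENNReal.ofNat_ne_top).1 hle')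

lemma two_pow_mul_measureReal_le (hM : IsSteinMaximal Φ M) (hK : MeasurableSet K) (hKt : μ K ≠ ∞)
    {N : ℕ} {g : Fin N → V} (hg : μ K ≤ 2 * μ (K ∩ ⋃ i, {x | 1 < M (g i) x})) :
    2 ^ N * μ.real K ≤ 4 * ∑ ε : Fin N → ℤˣ, μ.real (K ∩ {x | 1 < M (∑ i, ε i • g i) x}) := by
  classical
  set E : (Fin N → ℤˣ) → Set G := fun ε => K ∩ {x | 1 < M (∑ i, ε i • g i) x}
  have hEt (ε : Fin N → ℤˣ) : μ (E ε) ≠ ∞ := measure_ne_top_of_subset Set.inter_subset_left hKt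
  have hcount : (2 ^ N : ℕ) * μ (K ∩ ⋃ i, {x | 1 < M (g i) x}) ≤ (2 : ℕ) * ∑ ε, μ (E ε) := by
    refine mul_measure_le_mul_sum_measure (fun ε => hK.inter (hM.measurableSet_lt _ 1)) ?_
    rintro x ⟨hxK, hx⟩
    obtain ⟨i, hi⟩ := Set.mem_iUnion.1 hx
    simpa [E, hxK] using hM.two_pow_le_two_mul_card g hi
  simp only [measureReal_def]
  rw [← ENNReal.toReal_sum fun ε _ => hEt ε]
  have : 2 ^ N * μ K ≤ 4 * ∑ ε, μ (E ε) :=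
    calc 2 ^ N * μ K ≤ 2 ^ N * (2 * μ (K ∩ ⋃ i, {x | 1 < M (g i) x})) := by gcongr
      _ = 2 * ((2 ^ N : ℕ) * μ (K ∩ ⋃ i, {x | 1 < M (g i) x})) := by push_cast; ring
      _ ≤ 2 * ((2 : ℕ) * ∑ ε, μ (E ε)) := by gcongr
      _ = 4 * ∑ ε, μ (E ε) := by push_cast; ring
  simpa using ENNReal.toReal_mono
    (ENNReal.mul_ne_top ENNReal.ofNat_ne_top (ENNReal.sum_ne_top.2 fun ε _ => hEt ε)) this

variable [MeasurableAdd G] [MeasurableNeg G] [MeasurableSub₂ G] [SFinite μ] [μ.IsAddLeftInvariant]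
  [μ.IsNegInvariant]

/-- The signed sums of `N` translates of `f` covering half of `K` are large on a quarter of `K`
on average, so that they cannot be small in mean square. -/
lemma sq_le_mul_norm_sq (hM : IsSteinMaximal Φ M) (hK : MeasurableSet K) (hB : MeasurableSet B)
    (hKB : ∀ x ∈ K, ∀ y ∈ K, x - y ∈ B) (hK0 : μ K ≠ 0) (hKt : μ K ≠ ∞) (hB0 : μ B ≠ 0)
    (hBt : μ B ≠ ∞) {A : ℝ} (hA : 0 < A)
    (h : ∀ f, ‖Φ f‖ ≤ A → μ.real (K ∩ {x | 1 < M f x}) ≤ μ.real K / 8) {f : V} {N : ℕ}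
    (hN : μ B ≤ N * μ (K ∩ {x | 1 < M f x})) : A ^ 2 ≤ 8 * N * ‖Φ f‖ ^ 2 := by
  set F := K ∩ {x | 1 < M f x}
  have hF : MeasurableSet F := hK.inter (hM.measurableSet_lt f 1)
  obtain ⟨v, hv⟩ := exists_translates_cover_half hF hK hB (fun x hx y hy => hKB x hx y hy.1)
    hB0 hBt hKt (measure_ne_top_of_subset Set.inter_subset_left hKt) hN
  choose g hgnorm hg using fun i => hM.exists_translate (v i) f
  have hlarge : 2 ^ N * μ.real K ≤
      4 * ∑ ε : Fin N → ℤˣ, μ.real (K ∩ {x | 1 < M (∑ i, ε i • g i) x}) := by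
    refine hM.two_pow_mul_measureReal_le hK hKt (hv.trans ?_)
    gcongr 2 * μ (K ∩ ⋃ i, ?_) with i
    intro x hx
    rw [Set.mem_ofPred_eq, hg]
    exact hx.2
  have hsmall := sum_measureReal_lt_le hKt hA h g
  simp only [hgnorm, Finset.sum_const, Finset.card_univ, Fintype.card_fin, nsmul_eq_mul] at hsmall
  have hKpos : 0 < 2 ^ N * μ.real K := mul_pos (by positivity) (ENNReal.toReal_pos hK0 hKt)
  have hone : 1 ≤ 4 * (1 / 8 + N * ‖Φ f‖ ^ 2 / A ^ 2) := by
    refine le_of_mul_le_mul_left ?_ hKpos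
    linarith
  have hdiv : 1 / 8 ≤ N * ‖Φ f‖ ^ 2 / A ^ 2 := by linarith
  rw [le_div_iff₀ (by positivity)] at hdiv
  linarith

lemma measureReal_one_lt_le (hM : IsSteinMaximal Φ M) (hK : MeasurableSet K)
    (hB : MeasurableSet B) (hKB : ∀ x ∈ K, ∀ y ∈ K, x - y ∈ B) (hKt : μ K ≠ ∞) (hBt : μ B ≠ ∞)
    {A : ℝ} (hA : 0 < A)
    (h : ∀ f, ‖Φ f‖ ≤ A → μ.real (K ∩ {x | 1 < M f x}) ≤ μ.real K / 8) (f : V) :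
    μ.real (K ∩ {x | 1 < M f x}) ≤ 16 * μ.real B / A ^ 2 * ‖Φ f‖ ^ 2 := by
  set F := K ∩ {x | 1 < M f x}
  rcases measureReal_nonneg.eq_or_lt' (a := μ.real F) with hF0 | hF0
  · rw [hF0]
    positivity
  have hμF : μ F ≠ 0 := (ENNReal.toReal_pos_iff.1 hF0).1.ne'
  obtain ⟨x, hx⟩ := nonempty_of_measure_ne_zero hμF
  have hFB : μ F ≤ μ B :=
    calc μ F ≤ μ ((x - ·) ⁻¹' B) := measure_mono fun y hy => hKB x hx.1 y hy.1
      _ = μ B := (μ.measurePreserving_sub_left x).measure_preimage hB.nullMeasurableSet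
  have hratio : 1 ≤ μ.real B / μ.real F := (one_le_div hF0).2 (ENNReal.toReal_mono hBt hFB)
  set N := ⌈μ.real B / μ.real F⌉₊
  have hN : μ B ≤ N * μ F := by
    have hle : μ.real B ≤ N * μ.real F := (div_le_iff₀ hF0).1 (Nat.le_ceil _)
    rw [← ENNReal.ofReal_toReal hBt]
    refine ENNReal.ofReal_le_of_le_toReal ?_
    simpa [measureReal_def, ENNReal.toReal_mul] using hle
  have hN' : (N : ℝ) ≤ 2 * (μ.real B / μ.real F) := by
    linarith [Nat.ceil_lt_add_one (zero_le_one.trans hratio)]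
  have hA' : A ^ 2 ≤ 16 * (μ.real B / μ.real F) * ‖Φ f‖ ^ 2 :=
    (hM.sq_le_mul_norm_sq hK hB hKB
      (fun hK0 => hμF (measure_mono_null Set.inter_subset_left hK0)) hKt
      (fun hB0 => hμF (le_zero_iff.1 (hB0 ▸ hFB))) hBt hA h hN).trans (by
        gcongr ?_ * _
        linarith)
  rw [div_mul_eq_mul_div, le_div_iff₀ (by positivity)]
  rw [← mul_div_assoc, div_mul_eq_mul_div, le_div_iff₀ hF0] at hA'
  linarith

theorem measureReal_lt_le (hM : IsSteinMaximal Φ M) (hK : MeasurableSet K)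
    (hB : MeasurableSet B) (hKB : ∀ x ∈ K, ∀ y ∈ K, x - y ∈ B) (hKt : μ K ≠ ∞) (hBt : μ B ≠ ∞)
    {A : ℝ} (hA : 0 < A)
    (h : ∀ f, ‖Φ f‖ ≤ A → μ.real (K ∩ {x | 1 < M f x}) ≤ μ.real K / 8) (f : V) {r : ℝ≥0}
    (hr : 0 < r) :
    μ.real (K ∩ {x | (r : ℝ≥0∞) < M f x}) ≤ 16 * μ.real B / A ^ 2 * (‖Φ f‖ / r) ^ 2 := by
  set c : 𝕜 := ((r : ℝ) : 𝕜)⁻¹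
  have hc : ‖c‖ = (r : ℝ)⁻¹ := by simp [c]
  have hscale (x : G) : 1 < M (c • f) x ↔ (r : ℝ≥0∞) < M f x := by
    rw [hM.smul, ← ofReal_norm c, hc, ENNReal.ofReal_inv_of_pos (NNReal.coe_pos.2 hr),
      ENNReal.ofReal_coe_nnreal, mul_comm, ← div_eq_mul_inv,
      ENNReal.lt_div_iff_mul_lt (.inl (mod_cast hr.ne')) (.inl ENNReal.coe_ne_top), one_mul]
  have hnorm : ‖Φ (c • f)‖ = ‖Φ f‖ / r := by
    rw [map_smul, norm_smul, hc, inv_mul_eq_div]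
  simpa only [hscale, hnorm] using hM.measureReal_one_lt_le hK hB hKB hKt hBt hA h (c • f)

end IsSteinMaximal

end Stein

lemma weakL2Norm_le_iff {α : Type*} [MeasurableSpace α] {g : α → ℝ≥0∞} {μ : Measure α}
    {C : ℝ≥0∞} :
    weakL2Norm g μ ≤ C ↔ ∀ r : ℝ≥0, (r : ℝ≥0∞) ^ 2 * μ {x | (r : ℝ≥0∞) < g x} ≤ C ^ 2 := by
  rw [weakL2Norm, iSup_le_iff]
  refine forall_congr' fun r => ?_
  rw [← ENNReal.pow_le_pow_left_iff two_ne_zero, mul_pow, ← ENNReal.rpow_mul_natCast]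
  norm_num

/-! ### Uniform bounds in measure from almost everywhere boundedness -/

section Baire

variable {α ι E : Type*} [MeasurableSpace α] [NormedAddCommGroup E] {μ ν : Measure α}

lemma measure_exists_add_lt_norm_le_of_tendstoInMeasure {F : Finset ι} {f : ℕ → ι → α → E}
    {g : ι → α → E} (h : ∀ q ∈ F, TendstoInMeasure μ (fun k => f k q) atTop (g q)) {c η : ℝ}
    (hη : 0 < η) {ε : ℝ≥0∞} (hf : ∀ k, μ {x | ∃ q ∈ F, c < ‖f k q x‖} ≤ ε) :
    μ {x | ∃ q ∈ F, c + η < ‖g q x‖} ≤ ε := by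
  have hsubset (k : ℕ) : {x | ∃ q ∈ F, c + η < ‖g q x‖} ⊆
      {x | ∃ q ∈ F, c < ‖f k q x‖} ∪ ⋃ q ∈ F, {x | η ≤ ‖f k q x - g q x‖} := by
    rintro x ⟨q, hq, hlt⟩
    by_cases hx : c < ‖f k q x‖
    · exact .inl ⟨q, hq, hx⟩
    · refine .inr (Set.mem_biUnion hq ?_)
      have := norm_sub_norm_le (g q x) (f k q x)
      rw [norm_sub_rev] at this
      rw [Set.mem_ofPred_eq]
      linarith
  have hle (k : ℕ) : μ {x | ∃ q ∈ F, c + η < ‖g q x‖} ≤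
      ε + ∑ q ∈ F, μ {x | η ≤ ‖f k q x - g q x‖} :=
    (measure_mono (hsubset k)).trans <| (measure_union_le _ _).trans <|
      add_le_add (hf k) (measure_biUnion_finset_le _ _)
  have hlim : Tendsto (fun k => ε + ∑ q ∈ F, μ {x | η ≤ ‖f k q x - g q x‖}) atTop (𝓝 ε) := by
    simpa using tendsto_const_nhds.add
      (tendsto_finsetSum F fun q hq => tendstoInMeasure_iff_norm.1 (h q hq) η hη)
  exact ge_of_tendsto' hlim hle

lemma measure_exists_lt_norm_le_of_tendstoInMeasure [Countable ι] {f : ℕ → ι → α → E}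
    {g : ι → α → E} (h : ∀ q, TendstoInMeasure μ (fun k => f k q) atTop (g q)) {c : ℝ}
    {ε : ℝ≥0∞} (hf : ∀ k, μ {x | ∃ q, c < ‖f k q x‖} ≤ ε) :
    μ {x | ∃ q, c < ‖g q x‖} ≤ ε := by
  classical
  let V (i : ℕ × Finset ι) : Set α := {x | ∃ q ∈ i.2, c + 1 / ((i.1 : ℝ) + 1) < ‖g q x‖}
  have hV : Monotone V := by
    rintro i j ⟨hij₁, hij₂⟩ x ⟨q, hq, hlt⟩
    refine ⟨q, hij₂ hq, lt_of_le_of_lt ?_ hlt⟩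
    gcongr
  have hiUnion : {x | ∃ q, c < ‖g q x‖} ⊆ ⋃ i, V i := by
    rintro x ⟨q, hlt⟩
    obtain ⟨m, hm⟩ := exists_nat_one_div_lt (sub_pos.2 hlt)
    exact Set.mem_iUnion.2 ⟨(m, {q}), q, Finset.mem_singleton_self q, by linarith⟩
  calc μ {x | ∃ q, c < ‖g q x‖} ≤ ⨆ i, μ (V i) :=
        (measure_mono hiUnion).trans_eq <| Directed.measure_iUnion fun i j =>
          ⟨i ⊔ j, hV le_sup_left, hV le_sup_right⟩
    _ ≤ ε := by
      refine iSup_le fun i => measure_exists_add_lt_norm_le_of_tendstoInMeasure (fun q _ => h q)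
        Nat.one_div_pos_of_nat fun k => le_trans (measure_mono ?_) (hf k)
      rintro x ⟨q, -, hq⟩
      exact ⟨q, hq⟩

lemma isClosed_measure_exists_lt_norm_le [Countable ι] {X : Type*} [TopologicalSpace X]
    [SequentialSpace X] {p : ℝ≥0∞} [Fact (1 ≤ p)] {T : ι → X → Lp E p μ}
    (hT : ∀ q, Continuous (T q)) (hνμ : ν ≤ μ) (c : ℝ) (ε : ℝ≥0∞) :
    IsClosed {g | ν {x | ∃ q, c < ‖T q g x‖} ≤ ε} := by
  refine IsSeqClosed.isClosed fun g g₀ hg hlim => ?_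
  refine measure_exists_lt_norm_le_of_tendstoInMeasure (fun q η hη => ?_) hg
  exact tendsto_of_tendsto_of_tendsto_of_le_of_le tendsto_const_nhds
    (tendstoInMeasure_of_tendsto_Lp (((hT q).tendsto g₀).comp hlim) η hη)
    (fun _ => zero_le) fun _ => hνμ _

lemma exists_measure_exists_natCast_lt_norm_le [Countable ι] [IsFiniteMeasure ν]
    {f : ι → α → E} (hf : ∀ q, AEStronglyMeasurable (f q) ν) {I : ℕ → Set ι} (hI : Antitone I)
    (hbdd : ∀ᵐ x ∂ν, ∃ j, ∃ C : ℝ, ∀ q ∈ I j, ‖f q x‖ ≤ C) {ε : ℝ≥0∞} (hε : 0 < ε) :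
    ∃ j : ℕ, ν {x | ∃ q : I j, (j : ℝ) < ‖f q x‖} ≤ ε := by
  have hanti : Antitone fun j : ℕ => {x | ∃ q : I j, (j : ℝ) < ‖f q x‖} := by
    rintro i j hij x ⟨⟨q, hq⟩, hlt⟩
    exact ⟨⟨q, hI hij hq⟩, lt_of_le_of_lt (Nat.cast_le.2 hij) hlt⟩
  have hnull (j : ℕ) : NullMeasurableSet {x | ∃ q : I j, (j : ℝ) < ‖f q x‖} ν := by
    rw [Set.ofPred_exists]
    exact .iUnion fun q => nullMeasurableSet_lt aemeasurable_const (hf q).norm.aemeasurable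
  have hzero : ν (⋂ j : ℕ, {x | ∃ q : I j, (j : ℝ) < ‖f q x‖}) = 0 := by
    refine measure_mono_null (fun x hx => ?_) (ae_iff.1 hbdd)
    rintro ⟨i, C, hC⟩
    obtain ⟨k, hk⟩ := exists_nat_ge C
    obtain ⟨⟨q, hq⟩, hlt⟩ := Set.mem_iInter.1 hx (max i k)
    have hCk : C ≤ (max i k : ℕ) := hk.trans (Nat.cast_le.2 (le_max_right i k))
    exact (hC q (hI (le_max_left i k) hq)).not_gt (hCk.trans_lt hlt)
  have hlim := tendsto_measure_iInter_atTop hnull hanti ⟨0, measure_ne_top _ _⟩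
  rw [hzero] at hlim
  exact (hlim.eventually_le_const hε).exists

variable {𝕜 X : Type*} [RCLike 𝕜] [NormedAddCommGroup X] [NormedSpace 𝕜 X] [NormedSpace 𝕜 E]
  {p : ℝ≥0∞}

lemma ae_forall_map_add_smul_sub [Countable ι] (T : ι → X →ₗ[𝕜] Lp E p μ) (g h : X) (a : 𝕜) :
    ∀ᵐ x ∂μ, ∀ q, T q (g + a • h) x - T q g x = a • T q h x := by
  refine ae_all_iff.2 fun q => ?_
  filter_upwards [Lp.coeFn_add (T q g) (a • T q h), Lp.coeFn_smul a (T q h)] with x hadd hsmul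
  rw [map_add, map_smul, hadd, Pi.add_apply, hsmul, Pi.smul_apply, add_sub_cancel_left]

lemma exists_pos_measure_exists_one_lt_norm_le_of_mem_nhds [Countable ι]
    {T : ι → X →ₗ[𝕜] Lp E p μ} (hνμ : ν ≤ μ) {c : ℝ} (hc : 0 ≤ c) {ε : ℝ≥0∞} {g₀ : X}
    (hg₀ : {g | ν {x | ∃ q, c < ‖T q g x‖} ≤ ε} ∈ 𝓝 g₀) :
    ∃ A > 0, ∀ g, ‖g‖ ≤ A → ν {x | ∃ q, 1 < ‖T q g x‖} ≤ 2 * ε := by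
  let a : 𝕜 := ((2 * c + 1 : ℝ) : 𝕜)
  have ha : ‖a‖ = 2 * c + 1 := RCLike.norm_of_nonneg (by positivity)
  have hcont : Tendsto (fun g => g₀ + a • g) (𝓝 0) (𝓝 g₀) :=
    (by fun_prop : Continuous fun g => g₀ + a • g).tendsto' 0 g₀ (by simp)
  obtain ⟨A, hA, hball⟩ := Metric.nhds_basis_closedBall.mem_iff.1 (hcont hg₀)
  refine ⟨A, hA, fun g hg => ?_⟩
  have hshift : ν {x | ∃ q, c < ‖T q (g₀ + a • g) x‖} ≤ ε := hball (by simpa using hg)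
  have hcenter : ν {x | ∃ q, c < ‖T q g₀ x‖} ≤ ε := (mem_of_mem_nhds hg₀ :)
  refine le_trans (measure_mono_ae ?_) ((measure_union_le _ _).trans
    ((add_le_add hshift hcenter).trans_eq (two_mul ε).symm))
  filter_upwards [ae_mono hνμ (ae_forall_map_add_smul_sub T g₀ g a)] with x hx
  rintro ⟨q, hq⟩
  by_contra! hle
  have hle₁ : ‖T q (g₀ + a • g) x‖ ≤ c := not_lt.1 fun hlt => hle (.inl ⟨q, hlt⟩)
  have hle₂ : ‖T q g₀ x‖ ≤ c := not_lt.1 fun hlt => hle (.inr ⟨q, hlt⟩)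
  have hdiff : (2 * c + 1) * ‖T q g x‖ ≤ 2 * c := by
    rw [← ha, ← norm_smul, ← hx]
    exact (norm_sub_le _ _).trans (by linarith)
  nlinarith

theorem exists_measure_exists_one_lt_norm_le [Countable ι] [CompleteSpace X] [Fact (1 ≤ p)]
    [IsFiniteMeasure ν] (hνμ : ν ≤ μ) (T : ι → X →L[𝕜] Lp E p μ) {I : ℕ → Set ι} (hI : Antitone I)
    (hT : ∀ g, ∀ᵐ x ∂ν, ∃ j, ∃ C : ℝ, ∀ q ∈ I j, ‖T q g x‖ ≤ C) {ε : ℝ≥0∞} (hε : 0 < ε) :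
    ∃ j, ∃ A > 0, ∀ g, ‖g‖ ≤ A → ν {x | ∃ q : I j, 1 < ‖T q g x‖} ≤ 2 * ε := by
  let S (j : ℕ) : Set X := {g | ν {x | ∃ q : I j, (j : ℝ) < ‖T q g x‖} ≤ ε}
  have hS : ⋃ j, S j = Set.univ := Set.eq_univ_of_forall fun g => Set.mem_iUnion.2 <|
    exists_measure_exists_natCast_lt_norm_le
      (fun q => (Lp.aestronglyMeasurable (T q g)).mono_measure hνμ) hI (hT g) hε
  obtain ⟨j, g₀, hg₀⟩ := nonempty_interior_of_iUnion_of_closed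
    (fun j => isClosed_measure_exists_lt_norm_le (fun q : I j => (T q).continuous) hνμ j ε) hS
  exact ⟨j, exists_pos_measure_exists_one_lt_norm_le_of_mem_nhds
    (T := fun q : I j => (T q).toLinearMap) hνμ j.cast_nonneg (mem_interior_iff_mem_nhds.1 hg₀)⟩

end Baire

variable {n : ℕ}

local notation "ℝⁿ" => EuclideanSpace ℝ (Fin n)

local notation "L²" => Lp ℂ 2 (volume : Measure (EuclideanSpace ℝ (Fin n)))

/-! ### Fourier multipliers of Schwartz functions -/

section Multiplier

variable {V F : Type*} [NormedAddCommGroup V] [InnerProductSpace ℝ V] [FiniteDimensional ℝ V]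
  [MeasurableSpace V] [BorelSpace V] [NormedAddCommGroup F] [NormedSpace ℂ F]

lemma iteratedDeriv_cexp_I_mul (k : ℕ) (r : ℝ) :
    iteratedDeriv k (fun r : ℝ => Complex.exp (Complex.I * r)) r =
      Complex.I ^ k * Complex.exp (Complex.I * r) := by
  induction k generalizing r with
  | zero => simp
  | succ k ih =>
    have h : HasDerivAt (fun r : ℝ => Complex.I * (r : ℂ)) (Complex.I * 1) r :=
      (Complex.ofRealCLM.hasDerivAt (x := r)).const_mul Complex.I
    rw [iteratedDeriv_succ, funext ih, (h.cexp.const_mul (Complex.I ^ k)).deriv]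
    ring

lemma hasTemperateGrowth_cexp_I_mul :
    (fun r : ℝ => Complex.exp (Complex.I * r)).HasTemperateGrowth := by
  refine ⟨(contDiff_const.mul Complex.ofRealCLM.contDiff).cexp, fun k => ⟨0, 1, fun r => ?_⟩⟩
  rw [norm_iteratedFDeriv_eq_norm_iteratedDeriv, iteratedDeriv_cexp_I_mul, norm_mul, mul_comm,
    Complex.norm_exp_I_mul_ofReal]
  simp

lemma fourier_fourierMultiplierCLM_apply [CompleteSpace F] {m : V → ℂ} (hm : m.HasTemperateGrowth)
    (f : 𝓢(V, F)) (ξ : V) : 𝓕 (SchwartzMap.fourierMultiplierCLM F m f) ξ = m ξ • 𝓕 f ξ := by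
  rw [SchwartzMap.fourierMultiplierCLM_apply, FourierTransform.fourier_fourierInv_eq,
    SchwartzMap.smulLeftCLM_apply_apply hm]

lemma fourier_compSubConstCLM_apply (a : V) (f : 𝓢(V, F)) (ξ : V) :
    𝓕 (SchwartzMap.compSubConstCLM ℂ a f) ξ =
      Complex.exp (Complex.I * ((-(2 * Real.pi * inner ℝ a ξ) : ℝ) : ℂ)) • 𝓕 f ξ := by
  have htranslate : ⇑(SchwartzMap.compSubConstCLM ℂ a f) = f ∘ fun v => v + -a :=
    funext fun v => by rw [SchwartzMap.compSubConstCLM_apply, Function.comp_apply, sub_eq_add_neg]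
  rw [SchwartzMap.fourier_coe, SchwartzMap.fourier_coe, htranslate]
  refine (congrFun (VectorFourier.fourierIntegral_comp_add_right Real.fourierChar volume
    (innerₗ V) f (-a)) ξ).trans ?_
  rw [Circle.smul_def, Real.fourierChar_apply, innerₗ_apply_apply, inner_neg_left, mul_neg,
    mul_comm Complex.I]
  rfl

end Multiplier

/-! ### The evolution of Schwartz functions -/

lemma hasTemperateGrowth_symbol (t : ℝ) : (symbol t : ℝⁿ → ℂ).HasTemperateGrowth := by
  have hphase : (fun ξ : ℝⁿ => (t * (2 * Real.pi) ^ 2) * ‖ξ‖ ^ 2).HasTemperateGrowth :=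
    (Function.HasTemperateGrowth.const _).mul (Function.hasTemperateGrowth_norm_sq _)
  convert! hasTemperateGrowth_cexp_I_mul.comp hphase using 1
  ext ξ
  rw [symbol, Function.comp_apply, mul_pow, mul_assoc]

lemma symbol_mul_symbol (t t' : ℝ) : (symbol t * symbol t' : ℝⁿ → ℂ) = symbol (t + t') := by
  ext ξ
  rw [Pi.mul_apply, symbol, symbol, symbol, ← Complex.exp_add]
  push_cast
  ring_nf

/-- The Schrödinger propagator `e^{itΔ}` as an operator on Schwartz functions. -/
def propagator (t : ℝ) : 𝓢(ℝⁿ, ℂ) →L[ℂ] 𝓢(ℝⁿ, ℂ) :=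
  SchwartzMap.fourierMultiplierCLM ℂ (symbol t)

lemma propagator_apply (t : ℝ) (f : 𝓢(ℝⁿ, ℂ)) (x : ℝⁿ) : propagator t f x = evolution t f x := by
  rw [propagator, SchwartzMap.fourierMultiplierCLM_apply, SchwartzMap.fourierInv_coe,
    Real.fourierInv_eq', evolution]
  congr 1 with ξ
  rw [SchwartzMap.smulLeftCLM_apply_apply (hasTemperateGrowth_symbol t), smul_eq_mul, smul_eq_mul,
    real_inner_comm, mul_comm Complex.I]
  ring_nf

lemma fourier_propagator_apply (t : ℝ) (f : 𝓢(ℝⁿ, ℂ)) (ξ : ℝⁿ) :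
    𝓕 (propagator t f) ξ = symbol t ξ * 𝓕 f ξ :=
  fourier_fourierMultiplierCLM_apply (hasTemperateGrowth_symbol t) f ξ

lemma continuous_evolution (t : ℝ) (f : 𝓢(ℝⁿ, ℂ)) : Continuous (evolution t f) := by
  rw [← funext (propagator_apply t f)]
  exact (propagator t f).continuous

lemma evolution_sub (t : ℝ) (f g : 𝓢(ℝⁿ, ℂ)) (x : ℝⁿ) :
    evolution t (f - g) x = evolution t f x - evolution t g x := by
  simp [← propagator_apply]

lemma evolution_smul (t : ℝ) (c : ℂ) (f : 𝓢(ℝⁿ, ℂ)) (x : ℝⁿ) :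
    evolution t (c • f) x = c * evolution t f x := by
  simp [← propagator_apply]

lemma evolution_propagator (t t' : ℝ) (f : 𝓢(ℝⁿ, ℂ)) (x : ℝⁿ) :
    evolution t (propagator t' f) x = evolution (t + t') f x := by
  rw [← propagator_apply, propagator, propagator,
    SchwartzMap.fourierMultiplierCLM_fourierMultiplierCLM_apply (hasTemperateGrowth_symbol t)
      (hasTemperateGrowth_symbol t'), symbol_mul_symbol, ← propagator_apply, propagator]

lemma evolution_compSubConstCLM (t : ℝ) (a : ℝⁿ) (f : 𝓢(ℝⁿ, ℂ)) (x : ℝⁿ) :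
    evolution t (SchwartzMap.compSubConstCLM ℂ a f) x = evolution t f (x - a) := by
  unfold evolution
  congr 1 with ξ
  have hphase : Complex.exp (Complex.I * ((2 * Real.pi * inner ℝ (x - a) ξ : ℝ) : ℂ)) =
      Complex.exp (Complex.I * ((2 * Real.pi * inner ℝ x ξ : ℝ) : ℂ)) *
        Complex.exp (Complex.I * ((-(2 * Real.pi * inner ℝ a ξ) : ℝ) : ℂ)) := by
    rw [← Complex.exp_add, inner_sub_left]
    push_cast
    ring_nf
  rw [fourier_compSubConstCLM_apply, hphase, smul_eq_mul]
  ring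

lemma continuous_evolution_time (f : 𝓢(ℝⁿ, ℂ)) (x : ℝⁿ) :
    Continuous fun t => evolution t f x := by
  unfold evolution
  refine continuous_of_dominated (bound := fun ξ => ‖𝓕 f ξ‖) (fun t => ?_) (fun t => ?_)
    (𝓕 f).integrable.norm ?_
  · have := continuous_symbol (n := n) t
    have := (𝓕 f).continuous
    exact Continuous.aestronglyMeasurable (by fun_prop)
  · refine Eventually.of_forall fun ξ => ?_
    rw [norm_mul, norm_mul, norm_symbol, Complex.norm_exp_I_mul_ofReal, mul_one, one_mul]
  · refine Eventually.of_forall fun ξ => ?_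
    unfold symbol
    fun_prop

lemma evolutionL2_toLp (t : ℝ) (f : 𝓢(ℝⁿ, ℂ)) :
    evolutionL2 t (f.toLp 2) = (propagator t f).toLp 2 := by
  rw [evolutionL2, propagator, SchwartzMap.fourierMultiplierCLM_apply,
    ← SchwartzMap.toLp_fourierInv_eq]
  refine congrArg _ (Lp.ext ?_)
  filter_upwards [(memLp_symbol_mul t (𝓕 (f.toLp 2))).coeFn_toLp, SchwartzMap.coeFn_toLp (𝓕 f) 2,
    SchwartzMap.coeFn_toLp (SchwartzMap.smulLeftCLM ℂ (symbol t) (𝓕 f)) 2] with ξ hL2 hf hsmul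
  rw [hL2, hsmul, SchwartzMap.toLp_fourier_eq, hf,
    SchwartzMap.smulLeftCLM_apply_apply (hasTemperateGrowth_symbol t), smul_eq_mul]

lemma coeFn_evolutionL2_toLp (t : ℝ) (f : 𝓢(ℝⁿ, ℂ)) :
    evolutionL2 t (f.toLp 2) =ᵐ[volume] evolution t f := by
  rw [evolutionL2_toLp, ← funext (propagator_apply t f)]
  exact SchwartzMap.coeFn_toLp _ 2 volume

/-! ### The Sobolev norm -/

/-- The weight `(1 + |2πξ|²)^{s/2}` of `H^s`, complex valued so that it can act as a Fourier
multiplier. -/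
def sobolevWeight (s : ℝ) (ξ : ℝⁿ) : ℂ :=
  (((1 + (2 * Real.pi * ‖ξ‖) ^ 2) ^ (s / 2) : ℝ) : ℂ)

lemma hasTemperateGrowth_sobolevWeight (s : ℝ) :
    (sobolevWeight s : ℝⁿ → ℂ).HasTemperateGrowth := by
  have h := (Function.hasTemperateGrowth_one_add_norm_sq_rpow ℝⁿ (s / 2)).comp
    ((2 * Real.pi) • ContinuousLinearMap.id ℝ ℝⁿ).hasTemperateGrowth
  convert! Function.Complex.hasTemperateGrowth_ofReal.comp h using 1
  ext ξ
  simp [sobolevWeight, norm_smul, abs_of_pos Real.pi_pos]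

lemma continuous_sobolevWeight (s : ℝ) : Continuous (sobolevWeight s : ℝⁿ → ℂ) :=
  (hasTemperateGrowth_sobolevWeight s).1.continuous

lemma norm_sobolevWeight (s : ℝ) (ξ : ℝⁿ) :
    ‖sobolevWeight s ξ‖ = (1 + (2 * Real.pi * ‖ξ‖) ^ 2) ^ (s / 2) :=
  Complex.norm_of_nonneg (by positivity)

lemma enorm_sobolevWeight_sq (s : ℝ) (ξ : ℝⁿ) :
    ‖sobolevWeight s ξ‖ₑ ^ 2 = ENNReal.ofReal ((1 + (2 * Real.pi * ‖ξ‖) ^ 2) ^ s) := by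
  rw [← ofReal_norm, norm_sobolevWeight, ← ENNReal.ofReal_pow (by positivity),
    ← Real.rpow_mul_natCast (by positivity), Nat.cast_ofNat, div_mul_cancel₀ _ two_ne_zero]

lemma sobolevWeight_mul_neg (s : ℝ) (ξ : ℝⁿ) : sobolevWeight s ξ * sobolevWeight (-s) ξ = 1 := by
  rw [sobolevWeight, sobolevWeight, ← Complex.ofReal_mul, ← Real.rpow_add (by positivity),
    neg_div, add_neg_cancel, Real.rpow_zero, Complex.ofReal_one]

lemma norm_sobolevWeight_neg_le {s : ℝ} (hs : 0 ≤ s) (ξ : ℝⁿ) : ‖sobolevWeight (-s) ξ‖ ≤ 1 := by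
  rw [norm_sobolevWeight]
  exact Real.rpow_le_one_of_one_le_of_nonpos (le_add_of_nonneg_right (by positivity)) (by linarith)

lemma sobolevNorm_eq_eLpNorm (s : ℝ) (f : L²) :
    sobolevNorm s f = eLpNorm (fun ξ => sobolevWeight s ξ * (𝓕 f : L²) ξ) 2 volume := by
  rw [sobolevNorm, eLpNorm_eq_lintegral_rpow_enorm_toReal two_ne_zero ENNReal.ofNat_ne_top]
  simp only [ENNReal.toReal_ofNat, ENNReal.rpow_ofNat, enorm_mul, mul_pow, enorm_sobolevWeight_sq]

lemma sobolevNorm_mono {s s' : ℝ} (h : s ≤ s') (f : L²) : sobolevNorm s f ≤ sobolevNorm s' f := by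
  unfold sobolevNorm
  gcongr
  exact le_add_of_nonneg_right (by positivity)

/-- The map `f ↦ (1 + |2πξ|²)^{s/2} 𝓕 f` from Schwartz functions to `L²`, through which the
`H^s` norm becomes a Hilbert space norm. -/
def sobolevEmb (s : ℝ) : 𝓢(ℝⁿ, ℂ) →L[ℂ] L² :=
  SchwartzMap.toLpCLM ℂ ℂ 2 volume ∘L SchwartzMap.smulLeftCLM ℂ (sobolevWeight s) ∘L
    FourierTransform.fourierCLM ℂ 𝓢(ℝⁿ, ℂ)

lemma coeFn_sobolevEmb (s : ℝ) (f : 𝓢(ℝⁿ, ℂ)) :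
    sobolevEmb s f =ᵐ[volume] fun ξ => sobolevWeight s ξ * 𝓕 f ξ := by
  filter_upwards [SchwartzMap.coeFn_toLp (SchwartzMap.smulLeftCLM ℂ (sobolevWeight s) (𝓕 f)) 2]
    with ξ hξ
  rw [← smul_eq_mul, ← SchwartzMap.smulLeftCLM_apply_apply (hasTemperateGrowth_sobolevWeight s)]
  exact hξ

lemma sobolevNorm_toLp (s : ℝ) (f : 𝓢(ℝⁿ, ℂ)) : sobolevNorm s (f.toLp 2) = ‖sobolevEmb s f‖ₑ := by
  rw [sobolevNorm_eq_eLpNorm, Lp.enorm_def, SchwartzMap.toLp_fourier_eq]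
  refine eLpNorm_congr_ae ?_
  filter_upwards [SchwartzMap.coeFn_toLp (𝓕 f) 2, coeFn_sobolevEmb s f] with ξ hf hemb
  rw [hf, hemb]

lemma norm_sobolevEmb_congr (s : ℝ) {f g : 𝓢(ℝⁿ, ℂ)} (h : ∀ ξ, ‖𝓕 f ξ‖ = ‖𝓕 g ξ‖) :
    ‖sobolevEmb s f‖ = ‖sobolevEmb s g‖ := by
  rw [Lp.norm_def, Lp.norm_def]
  congr 1
  refine eLpNorm_congr_norm_ae ?_
  filter_upwards [coeFn_sobolevEmb s f, coeFn_sobolevEmb s g] with ξ hf hg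
  rw [hf, hg, norm_mul, norm_mul, h]

lemma norm_sobolevEmb_propagator (s t : ℝ) (f : 𝓢(ℝⁿ, ℂ)) :
    ‖sobolevEmb s (propagator t f)‖ = ‖sobolevEmb s f‖ :=
  norm_sobolevEmb_congr s fun ξ => by
    rw [fourier_propagator_apply, norm_mul, norm_symbol, one_mul]

lemma norm_sobolevEmb_compSubConstCLM (s : ℝ) (a : ℝⁿ) (f : 𝓢(ℝⁿ, ℂ)) :
    ‖sobolevEmb s (SchwartzMap.compSubConstCLM ℂ a f)‖ = ‖sobolevEmb s f‖ :=
  norm_sobolevEmb_congr s fun ξ => by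
    rw [fourier_compSubConstCLM_apply, norm_smul, Complex.norm_exp_I_mul_ofReal, one_mul]

/-! ### Maximal functions over short time intervals -/

/-- The local maximal function `x ↦ sup_{0 < t < δ} |e^{itΔ} f(x)|`. -/
def localMaximal (δ : ℝ) (f : 𝓢(ℝⁿ, ℂ)) (x : ℝⁿ) : ℝ≥0∞ :=
  ⨆ t ∈ Set.Ioo (0 : ℝ) δ, ‖evolution t f x‖ₑ

lemma maximalFunction_eq_localMaximal (f : 𝓢(ℝⁿ, ℂ)) : maximalFunction f = localMaximal 1 f :=
  rfl

lemma lt_localMaximal_iff {δ : ℝ} {f : 𝓢(ℝⁿ, ℂ)} {x : ℝⁿ} {r : ℝ≥0∞} :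
    r < localMaximal δ f x ↔ ∃ t ∈ Set.Ioo (0 : ℝ) δ, r < ‖evolution t f x‖ₑ := by
  simp only [localMaximal, lt_iSup_iff, exists_prop]

lemma lowerSemicontinuous_localMaximal (δ : ℝ) (f : 𝓢(ℝⁿ, ℂ)) :
    LowerSemicontinuous (localMaximal δ f) :=
  lowerSemicontinuous_biSup fun t _ => (continuous_evolution t f).enorm.lowerSemicontinuous

lemma isSteinMaximal_localMaximal (s δ : ℝ) :
    IsSteinMaximal (sobolevEmb s).toLinearMap (localMaximal (n := n) δ) where
  measurable f := (lowerSemicontinuous_localMaximal δ f).measurable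
  sub_le f g x := iSup₂_le fun t ht => by
    rw [evolution_sub]
    exact (enorm_sub_le).trans
      (add_le_add (le_iSup₂_of_le t ht le_rfl) (le_iSup₂_of_le t ht le_rfl))
  smul c f x := by simp only [localMaximal, evolution_smul, enorm_mul, ENNReal.mul_iSup]
  exists_translate a f := ⟨SchwartzMap.compSubConstCLM ℂ a f,
    norm_sobolevEmb_compSubConstCLM s a f, fun x => by
      simp only [localMaximal, evolution_compSubConstCLM]⟩

/-! ### Bounded multipliers on `L²` -/

section BoundedMultiplier

variable {α : Type*} [MeasurableSpace α] {μ : Measure α} {p : ℝ≥0∞} [Fact (1 ≤ p)]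

/-- Multiplication by an essentially bounded function, as an operator on `Lᵖ`. -/
def boundedMul {m : α → ℂ} (hm : MemLp m ∞ μ) : Lp ℂ p μ →L[ℂ] Lp ℂ p μ :=
  (ContinuousLinearMap.mul ℂ ℂ).holderL μ ∞ p p hm.toLp

lemma coeFn_boundedMul {m : α → ℂ} (hm : MemLp m ∞ μ) (g : Lp ℂ p μ) :
    boundedMul hm g =ᵐ[μ] fun ξ => m ξ * g ξ := by
  have hholder : boundedMul hm g = (ContinuousLinearMap.mul ℂ ℂ).holder p hm.toLp g := rfl
  rw [hholder]
  filter_upwards [(ContinuousLinearMap.mul ℂ ℂ).coeFn_holder (r := p) hm.toLp g, hm.coeFn_toLp]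
    with ξ hmul hmξ
  rw [hmul, hmξ, ContinuousLinearMap.mul_apply']

end BoundedMultiplier

lemma memLp_top_symbol (t : ℝ) : MemLp (symbol t : ℝⁿ → ℂ) ∞ volume :=
  memLp_top_of_bound (continuous_symbol t).aestronglyMeasurable 1
    (ae_of_all _ fun ξ => (norm_symbol t ξ).le)

/-- The operator `e^{itΔ}` on `L²`, bundled as a continuous linear map. -/
def evolutionL2CLM (t : ℝ) : L² →L[ℂ] L² :=
  fourierInvCLM ℂ L² ∘L boundedMul (memLp_top_symbol t) ∘L fourierCLM ℂ L²

lemma evolutionL2CLM_apply (t : ℝ) (f : L²) : evolutionL2CLM t f = evolutionL2 t f := by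
  have h : boundedMul (memLp_top_symbol t) (𝓕 f : L²) = (memLp_symbol_mul t (𝓕 f)).toLp :=
    Lp.ext ((coeFn_boundedMul (memLp_top_symbol t) (𝓕 f : L²)).trans
      (memLp_symbol_mul t (𝓕 f)).coeFn_toLp.symm)
  rw [evolutionL2, ← h]
  rfl

lemma memLp_top_sobolevWeight_neg {s : ℝ} (hs : 0 ≤ s) :
    MemLp (sobolevWeight (-s) : ℝⁿ → ℂ) ∞ volume :=
  memLp_top_of_bound (continuous_sobolevWeight (-s)).aestronglyMeasurable 1
    (ae_of_all _ (norm_sobolevWeight_neg_le hs))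

/-- The operator `g ↦ 𝓕⁻ ((1 + |2πξ|²)^{-s/2} g)`, which maps `L²` isometrically onto `H^s`. -/
def sobolevLift {s : ℝ} (hs : 0 ≤ s) : L² →L[ℂ] L² :=
  fourierInvCLM ℂ L² ∘L boundedMul (memLp_top_sobolevWeight_neg hs)

lemma coeFn_fourier_sobolevLift {s : ℝ} (hs : 0 ≤ s) (g : L²) :
    (𝓕 (sobolevLift hs g) : L²) =ᵐ[volume] fun ξ => sobolevWeight (-s) ξ * g ξ := by
  have h : (𝓕 (sobolevLift hs g) : L²) = boundedMul (memLp_top_sobolevWeight_neg hs) g :=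
    fourier_fourierInv_eq _
  rw [h]
  exact coeFn_boundedMul _ g

lemma sobolevNorm_sobolevLift {s : ℝ} (hs : 0 ≤ s) (g : L²) :
    sobolevNorm s (sobolevLift hs g) = ‖g‖ₑ := by
  rw [sobolevNorm_eq_eLpNorm, Lp.enorm_def]
  refine eLpNorm_congr_ae ?_
  filter_upwards [coeFn_fourier_sobolevLift hs g] with ξ hξ
  rw [hξ, ← mul_assoc, sobolevWeight_mul_neg, one_mul]

lemma sobolevLift_sobolevEmb {s : ℝ} (hs : 0 ≤ s) (f : 𝓢(ℝⁿ, ℂ)) :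
    sobolevLift hs (sobolevEmb s f) = f.toLp 2 := by
  refine (Lp.fourierTransformₗᵢ ℝⁿ ℂ).injective (Lp.ext ?_)
  change (𝓕 (sobolevLift hs (sobolevEmb s f)) : L²) =ᵐ[volume] (𝓕 (f.toLp 2) : L²)
  rw [SchwartzMap.toLp_fourier_eq]
  filter_upwards [coeFn_fourier_sobolevLift hs (sobolevEmb s f), coeFn_sobolevEmb s f,
    SchwartzMap.coeFn_toLp (𝓕 f) 2 volume] with ξ hlift hemb hf
  rw [hlift, hemb, hf, ← mul_assoc, mul_comm (sobolevWeight (-s) ξ), sobolevWeight_mul_neg,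
    one_mul]

/-! ### Almost everywhere convergence implies the maximal estimate -/

lemma ConvergesAE.exists_norm_evolutionL2_le {f : L²} (hf : ConvergesAE f) :
    ∀ᵐ x, ∃ δ > 0, ∃ C : ℝ, ∀ q : ℚ, (q : ℝ) ∈ Set.Ioo 0 δ → ‖evolutionL2 q f x‖ ≤ C := by
  obtain ⟨u, hu, hlim⟩ := hf
  have hae : ∀ᵐ x, ∀ q : ℚ, (q : ℝ) ∈ Set.Ioo (0 : ℝ) 1 → u x q = evolutionL2 q f x := by
    refine ae_all_iff.2 fun q => ?_
    by_cases hq : (q : ℝ) ∈ Set.Ioo (0 : ℝ) 1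
    · filter_upwards [hu q hq] with x hx _ using hx
    · exact ae_of_all _ fun x h => absurd h hq
  filter_upwards [hae, hlim] with x hx hxlim
  obtain ⟨δ, hδ, hbound⟩ := (nhdsGT_basis (0 : ℝ)).eventually_iff.1 <|
    (eventually_mem_set.2 (Ioo_mem_nhdsGT one_pos)).and
      (hxlim.norm.eventually_lt_const (lt_add_one ‖f x‖))
  refine ⟨δ, hδ, ‖f x‖ + 1, fun q hq => ?_⟩
  rw [← hx q (hbound hq).1]
  exact (hbound hq).2.le

lemma exists_rat_lt_norm_evolution {δ r : ℝ} {f : 𝓢(ℝⁿ, ℂ)} {x : ℝⁿ}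
    (h : ENNReal.ofReal r < localMaximal δ f x) :
    ∃ q : ℚ, (q : ℝ) ∈ Set.Ioo 0 δ ∧ r < ‖evolution q f x‖ := by
  obtain ⟨t, ht, hlt⟩ := lt_localMaximal_iff.1 h
  rw [← ofReal_norm] at hlt
  have hopen : IsOpen (Set.Ioo (0 : ℝ) δ ∩ {t | r < ‖evolution t f x‖}) :=
    isOpen_Ioo.inter (isOpen_lt continuous_const (continuous_evolution_time f x).norm)
  exact Rat.denseRange_cast.exists_mem_open hopen ⟨t, ht, lt_of_not_ge fun hle =>
    hlt.not_ge (ENNReal.ofReal_le_ofReal hle)⟩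

lemma ConvergesAEOnSobolev.exists_volume_real_le {s : ℝ} (hs : 0 ≤ s)
    (h : ConvergesAEOnSobolev n s) :
    ∃ δ > 0, ∃ A > 0, ∀ f : 𝓢(ℝⁿ, ℂ), ‖sobolevEmb s f‖ ≤ A →
      volume.real (Metric.ball 0 1 ∩ {x | 1 < localMaximal δ f x}) ≤
        volume.real (Metric.ball (0 : ℝⁿ) 1) / 8 := by
  let K : Set ℝⁿ := Metric.ball 0 1
  let I (j : ℕ) : Set ℚ := {q | (q : ℝ) ∈ Set.Ioo (0 : ℝ) (1 / (j + 1))}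
  let T (q : ℚ) : L² →L[ℂ] L² := evolutionL2CLM q ∘L sobolevLift hs
  have hKt : volume K ≠ ∞ := measure_ball_lt_top.ne
  have : IsFiniteMeasure (volume.restrict K) := isFiniteMeasure_restrict.2 hKt
  have hI : Antitone I := fun i j hij q hq =>
    ⟨hq.1, hq.2.trans_le (Nat.one_div_le_one_div hij)⟩
  have hT (g : L²) : ∀ᵐ x ∂volume.restrict K, ∃ j, ∃ C : ℝ, ∀ q ∈ I j, ‖T q g x‖ ≤ C := by
    have hconv := h (sobolevLift hs g) (by rw [sobolevNorm_sobolevLift]; exact enorm_lt_top)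
    filter_upwards [ae_restrict_of_ae hconv.exists_norm_evolutionL2_le] with x ⟨δ, hδ, C, hC⟩
    obtain ⟨j, hj⟩ := exists_nat_one_div_lt hδ
    refine ⟨j, C, fun q hq => ?_⟩
    simpa only [T, ContinuousLinearMap.comp_apply, evolutionL2CLM_apply]
      using hC q ⟨hq.1, hq.2.trans hj⟩
  have hTf (f : 𝓢(ℝⁿ, ℂ)) : ∀ᵐ x, ∀ q, T q (sobolevEmb s f) x = evolution q f x := by
    refine ae_all_iff.2 fun q => ?_
    simp only [T, ContinuousLinearMap.comp_apply, sobolevLift_sobolevEmb, evolutionL2CLM_apply]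
    exact coeFn_evolutionL2_toLp q f
  obtain ⟨j, A, hA, hsmall⟩ := exists_measure_exists_one_lt_norm_le Measure.restrict_le_self T hI
    hT (ε := volume K / 16)
    (ENNReal.div_pos (Metric.measure_ball_pos volume 0 one_pos).ne' (by finiteness))
  refine ⟨1 / (j + 1), by positivity, A, hA, fun f hf => ?_⟩
  have hle : volume (K ∩ {x | 1 < localMaximal (1 / (j + 1)) f x}) ≤ 2 * (volume K / 16) := by
    rw [Set.inter_comm, ← Measure.restrict_apply' measurableSet_ball]
    refine (measure_mono_ae ?_).trans (hsmall _ hf)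
    filter_upwards [ae_restrict_of_ae (hTf f)] with x hx hlt
    obtain ⟨q, hq, hlt'⟩ := exists_rat_lt_norm_evolution (ENNReal.ofReal_one.trans_lt hlt)
    exact ⟨⟨q, hq⟩, (hx q).symm ▸ hlt'⟩
  have hreal := ENNReal.toReal_mono (by finiteness) hle
  rw [ENNReal.toReal_mul, ENNReal.toReal_div, ENNReal.toReal_ofNat, ENNReal.toReal_ofNat] at hreal
  simp only [Measure.real, K] at hreal ⊢
  linarith

lemma lt_localMaximal_one_subset {δ : ℝ} (hδ : 0 < δ) (f : 𝓢(ℝⁿ, ℂ)) (r : ℝ≥0∞) :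
    {x | r < localMaximal 1 f x} ⊆ ⋃ i ∈ Finset.range ⌈2 / δ⌉₊,
      {x | r < localMaximal δ (propagator (i * (δ / 2)) f) x} := by
  intro x hx
  obtain ⟨t, ⟨ht0, ht1⟩, hlt⟩ := lt_localMaximal_iff.1 hx
  have hpos : 0 < t / (δ / 2) := by positivity
  obtain ⟨i, hi⟩ := Nat.exists_eq_succ_of_ne_zero (Nat.ceil_pos.2 hpos).ne'
  have hlower : (i : ℝ) * (δ / 2) < t := by
    rw [← lt_div_iff₀ (by positivity), ← Nat.lt_ceil]
    lia
  have hupper : t ≤ (i + 1) * (δ / 2) := by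
    rw [← div_le_iff₀ (by positivity)]
    exact_mod_cast hi ▸ Nat.le_ceil (t / (δ / 2))
  have hirange : (i : ℝ) < 2 / δ := by
    rw [lt_div_iff₀ hδ]
    linarith
  refine Set.mem_biUnion (x := i) (by simpa using Nat.lt_ceil.2 hirange)
    (lt_localMaximal_iff.2 ⟨t - i * (δ / 2), ⟨by linarith, by linarith⟩, ?_⟩)
  rwa [evolution_propagator, sub_add_cancel]

lemma volume_real_lt_maximalFunction_le {K : Set ℝⁿ} (hK : volume K ≠ ∞) {δ : ℝ} (hδ : 0 < δ)
    {r : ℝ≥0∞} {D : ℝ} {f : 𝓢(ℝⁿ, ℂ)}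
    (h : ∀ t, volume.real (K ∩ {x | r < localMaximal δ (propagator t f) x}) ≤ D) :
    volume.real (K ∩ {x | r < maximalFunction f x}) ≤ ⌈2 / δ⌉₊ * D := by
  have hsub : K ∩ {x | r < maximalFunction f x} ⊆ ⋃ i ∈ Finset.range ⌈2 / δ⌉₊,
      K ∩ {x | r < localMaximal δ (propagator (i * (δ / 2)) f) x} := by
    rw [← Set.inter_iUnion₂]
    exact Set.inter_subset_inter_right _ (lt_localMaximal_one_subset hδ f r)
  have hfin : volume (⋃ i ∈ Finset.range ⌈2 / δ⌉₊,
      K ∩ {x | r < localMaximal δ (propagator (i * (δ / 2)) f) x}) ≠ ∞ :=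
    measure_ne_top_of_subset (Set.iUnion₂_subset fun _ _ => Set.inter_subset_left) hK
  calc volume.real (K ∩ {x | r < maximalFunction f x})
      ≤ ∑ i ∈ Finset.range ⌈2 / δ⌉₊,
          volume.real (K ∩ {x | r < localMaximal δ (propagator (i * (δ / 2)) f) x}) :=
        (measureReal_mono hsub hfin).trans (measureReal_biUnion_finset_le _ _)
    _ ≤ ⌈2 / δ⌉₊ * D := by
        simpa using Finset.sum_le_card_nsmul (Finset.range ⌈2 / δ⌉₊) _ D fun i _ => h _

lemma weakL2Norm_restrict_le {α : Type*} [MeasurableSpace α] {g : α → ℝ≥0∞} {μ : Measure α}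
    {K : Set α} (hK : MeasurableSet K) (hKt : μ K ≠ ∞) {D a : ℝ} (hD : 0 ≤ D)
    (ha : 0 ≤ a)
    (h : ∀ r : ℝ≥0, 0 < r → μ.real (K ∩ {x | (r : ℝ≥0∞) < g x}) ≤ D * (a / r) ^ 2) :
    weakL2Norm g (μ.restrict K) ≤ ENNReal.ofReal (√D * a) := by
  refine weakL2Norm_le_iff.2 fun r => ?_
  rcases eq_zero_or_pos r with rfl | hr
  · simp
  have hr' : (0 : ℝ) < r := hr
  have hle : μ (K ∩ {x | (r : ℝ≥0∞) < g x}) ≤ ENNReal.ofReal (D * (a / r) ^ 2) :=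
    (ENNReal.le_ofReal_iff_toReal_le (measure_ne_top_of_subset Set.inter_subset_left hKt)
      (by positivity)).2 (h r hr)
  rw [Measure.restrict_apply' hK, Set.inter_comm]
  calc (r : ℝ≥0∞) ^ 2 * μ (K ∩ {x | (r : ℝ≥0∞) < g x})
      ≤ ENNReal.ofReal (r ^ 2) * ENNReal.ofReal (D * (a / r) ^ 2) := by
        rw [ENNReal.ofReal_pow hr'.le, ENNReal.ofReal_coe_nnreal]
        gcongr
    _ = ENNReal.ofReal (√D * a) ^ 2 := by
        rw [← ENNReal.ofReal_mul (by positivity), ← ENNReal.ofReal_pow (by positivity), mul_pow,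
          Real.sq_sqrt hD]
        congr 1
        field_simp

theorem ConvergesAEOnSobolev.maximalBounded {s : ℝ} (hs : 0 ≤ s)
    (h : ConvergesAEOnSobolev n s) : MaximalBounded n s := by
  obtain ⟨δ, hδ, A, hA, hsmall⟩ := h.exists_volume_real_le hs
  let K : Set ℝⁿ := Metric.ball 0 1
  let D := 16 * volume.real (Metric.ball (0 : ℝⁿ) 2) / A ^ 2
  have hKB (x) (hx : x ∈ K) (y) (hy : y ∈ K) : x - y ∈ Metric.ball (0 : ℝⁿ) 2 := by
    rw [mem_ball_zero_iff] at hx hy ⊢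
    linarith [norm_sub_le x y]
  have hstein (f : 𝓢(ℝⁿ, ℂ)) {r : ℝ≥0} (hr : 0 < r) :
      volume.real (K ∩ {x | (r : ℝ≥0∞) < localMaximal δ f x}) ≤
        D * (‖sobolevEmb s f‖ / r) ^ 2 :=
    (isSteinMaximal_localMaximal s δ).measureReal_lt_le measurableSet_ball measurableSet_ball hKB
      measure_ball_lt_top.ne measure_ball_lt_top.ne hA hsmall f hr
  refine ⟨(√(⌈2 / δ⌉₊ * D)).toNNReal, fun f => ?_⟩
  rw [sobolevNorm_toLp, ← ofReal_norm, ← ENNReal.ofReal, ← ENNReal.ofReal_mul (by positivity)]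
  refine weakL2Norm_restrict_le measurableSet_ball measure_ball_lt_top.ne (by positivity)
    (norm_nonneg _) fun r hr => ?_
  rw [mul_assoc]
  refine volume_real_lt_maximalFunction_le measure_ball_lt_top.ne hδ fun t => ?_
  rw [← norm_sobolevEmb_propagator s t f]
  exact hstein _ hr

/-! ### The maximal estimate implies almost everywhere convergence -/

section GeneralFacts

variable {α β E : Type*}

lemma exists_seq_tendsto_and_dist_succ_le [PseudoMetricSpace β] {f : α → β} (hf : DenseRange f)
    (b : β) {r : ℝ} (hr0 : 0 < r) (hr1 : r < 1) :
    ∃ φ : ℕ → α, Tendsto (fun k => f (φ k)) atTop (𝓝 b) ∧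
      ∀ k, dist (f (φ (k + 1))) (f (φ k)) ≤ r ^ k := by
  choose φ hφ using fun k : ℕ => hf.exists_dist_lt b (ε := r ^ k / 2) (by positivity)
  refine ⟨φ, ?_, fun k => ?_⟩
  · refine tendsto_iff_dist_tendsto_zero.2 (squeeze_zero (fun _ => dist_nonneg)
      (fun k => (dist_comm _ _).trans_le (hφ k).le) ?_)
    simpa using (tendsto_pow_atTop_nhds_zero_of_lt_one hr0.le hr1).div_const 2
  · have hpow : r ^ (k + 1) ≤ r ^ k := pow_le_pow_of_le_one hr0.le hr1.le k.le_succ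
    linarith [dist_triangle_left (f (φ (k + 1))) (f (φ k)) b, hφ k, hφ (k + 1)]

lemma tendstoUniformlyOn_limUnder_of_dist_le_geometric [MetricSpace E] [CompleteSpace E]
    [Nonempty E] {a : ℕ → α → E} {S : Set α} {r : ℝ} (hr0 : 0 ≤ r) (hr1 : r < 1)
    (h : ∀ᶠ k in atTop, ∀ t ∈ S, dist (a k t) (a (k + 1) t) ≤ r ^ k) :
    TendstoUniformlyOn a (fun t => limUnder atTop fun k => a k t) atTop S := by
  obtain ⟨K, hK⟩ := eventually_atTop.1 h
  have hstep (k) (hk : K ≤ k) (t) (ht : t ∈ S) (m : ℕ) :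
      dist (a (m + k) t) (a (m + 1 + k) t) ≤ r ^ k * r ^ m := by
    rw [← pow_add, add_comm k, add_right_comm m 1]
    exact hK (m + k) (by lia) t ht
  have hlim (t) (ht : t ∈ S) :
      Tendsto (fun k => a k t) atTop (𝓝 (limUnder atTop fun k => a k t)) := by
    obtain ⟨l, hl⟩ := cauchySeq_tendsto_of_complete
      (cauchySeq_of_le_geometric r _ hr1 (hstep K le_rfl t ht))
    exact tendsto_nhds_limUnder ⟨l, (tendsto_add_atTop_iff_nat K).1 hl⟩
  have hpow : Tendsto (fun k : ℕ => r ^ k / (1 - r)) atTop (𝓝 0) := by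
    simpa using (tendsto_pow_atTop_nhds_zero_of_lt_one hr0 hr1).div_const (1 - r)
  refine Metric.tendstoUniformlyOn_iff.2 fun ε hε => ?_
  filter_upwards [hpow.eventually_lt_const hε, eventually_ge_atTop K] with k hkε hk t ht
  have hdist := dist_le_of_le_geometric_of_tendsto₀ r _ hr1 (hstep k hk t ht)
    ((tendsto_add_atTop_iff_nat k).2 (hlim t ht))
  rw [zero_add, dist_comm] at hdist
  exact hdist.trans_lt hkε

variable [MeasurableSpace α] {μ : Measure α}

lemma ae_of_forall_ae_restrict_ball [PseudoMetricSpace α] [SecondCountableTopology α]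
    [OpensMeasurableSpace α] {p : α → Prop} {r : ℝ} (hr : 0 < r)
    (h : ∀ a, ∀ᵐ x ∂μ.restrict (Metric.ball a r), p x) : ∀ᵐ x ∂μ, p x := by
  refine measure_null_of_locally_null _ fun a _ => ⟨{x | ¬p x} ∩ Metric.ball a r,
    inter_mem_nhdsWithin _ (Metric.ball_mem_nhds a hr), ?_⟩
  rw [← Measure.restrict_apply' measurableSet_ball]
  exact h a

lemma weakL2Norm_comp {β : Type*} [MeasurableSpace β] {ν : Measure β} {T : α → β}
    (hT : MeasurePreserving T μ ν) {g : β → ℝ≥0∞} (hg : Measurable g) :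
    weakL2Norm (g ∘ T) μ = weakL2Norm g ν := by
  refine iSup_congr fun r => ?_
  rw [← hT.measure_preimage (measurableSet_lt measurable_const hg).nullMeasurableSet]
  rfl

lemma ae_eventually_le_of_weakL2Norm_le {g : ℕ → α → ℝ≥0∞} {C : ℝ≥0}
    (h : ∀ k, weakL2Norm (g k) μ ≤ C * 4⁻¹ ^ k) :
    ∀ᵐ x ∂μ, ∀ᶠ k in atTop, g k x ≤ (2⁻¹ ^ k : ℝ≥0) := by
  have hmeasure (k : ℕ) :
      μ {x | ((2⁻¹ ^ k : ℝ≥0) : ℝ≥0∞) < g k x} ≤ (C : ℝ≥0∞) ^ 2 * 4⁻¹ ^ k := by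
    have hpow : ((2⁻¹ ^ k : ℝ≥0) : ℝ≥0∞) ^ 2 = 4⁻¹ ^ k := by
      rw [ENNReal.coe_pow, ENNReal.coe_inv two_ne_zero, ENNReal.coe_ofNat, ← pow_mul, mul_comm k,
        pow_mul, ← ENNReal.inv_pow]
      norm_num
    have hk := weakL2Norm_le_iff.1 (h k) (2⁻¹ ^ k)
    rw [hpow, mul_pow, sq (4⁻¹ ^ k), ← mul_assoc, mul_comm] at hk
    exact (ENNReal.mul_le_mul_iff_left (pow_ne_zero k (by simp)) (by finiteness)).1 hk
  have hsum : ∑' k, μ {x | ((2⁻¹ ^ k : ℝ≥0) : ℝ≥0∞) < g k x} ≠ ∞ := by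
    refine ne_top_of_le_ne_top ?_ (ENNReal.tsum_le_tsum hmeasure)
    rw [ENNReal.tsum_mul_left]
    exact ENNReal.mul_ne_top (by simp)
      (tsum_geometric_lt_top.2 (ENNReal.inv_lt_one.2 (by norm_num))).ne
  filter_upwards [ae_eventually_notMem hsum] with x hx
  exact hx.mono fun k hk => not_lt.1 hk

lemma ae_eq_of_tendsto_Lp_of_tendsto_ae [NormedAddCommGroup E] {p : ℝ≥0∞} [Fact (1 ≤ p)]
    {f : ℕ → Lp E p μ} {g : Lp E p μ} {v : α → E} (hf : Tendsto f atTop (𝓝 g))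
    (hv : ∀ᵐ x ∂μ, Tendsto (fun k => f k x) atTop (𝓝 (v x))) : v =ᵐ[μ] g := by
  obtain ⟨ns, hns, hsub⟩ := (tendstoInMeasure_of_tendsto_Lp hf).exists_seq_tendsto_ae
  filter_upwards [hv, hsub] with x hx hxsub
  exact tendsto_nhds_unique (hx.comp hns.tendsto_atTop) hxsub

end GeneralFacts

lemma denseRange_sobolevEmb (s : ℝ) : DenseRange (sobolevEmb s : 𝓢(ℝⁿ, ℂ) → L²) := by
  have hsurj : Function.Surjective
      (SchwartzMap.smulLeftCLM ℂ (sobolevWeight s) ∘L fourierCLM ℂ 𝓢(ℝⁿ, ℂ)) := by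
    refine fun g => ⟨𝓕⁻ (SchwartzMap.smulLeftCLM ℂ (sobolevWeight (-s)) g), ?_⟩
    ext ξ
    rw [ContinuousLinearMap.comp_apply, fourierCLM_apply, fourier_fourierInv_eq,
      SchwartzMap.smulLeftCLM_apply_apply (hasTemperateGrowth_sobolevWeight s),
      SchwartzMap.smulLeftCLM_apply_apply (hasTemperateGrowth_sobolevWeight (-s)),
      smul_smul, sobolevWeight_mul_neg, one_smul]
  exact (SchwartzMap.denseRange_toLpCLM (p := 2) ENNReal.ofNat_ne_top).comp hsurj.denseRange
    (SchwartzMap.toLpCLM ℂ ℂ 2 volume).continuous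

lemma exists_sobolevLift_eq {s : ℝ} (hs : 0 ≤ s) {f : L²} (hf : sobolevNorm s f < ∞) :
    ∃ g, sobolevLift hs g = f := by
  rw [sobolevNorm_eq_eLpNorm] at hf
  have hmem : MemLp (fun ξ => sobolevWeight s ξ * (𝓕 f : L²) ξ) 2 volume :=
    ⟨(continuous_sobolevWeight s).aestronglyMeasurable.mul (Lp.aestronglyMeasurable _), hf⟩
  refine ⟨hmem.toLp, (Lp.fourierTransformₗᵢ ℝⁿ ℂ).injective (Lp.ext ?_)⟩
  change (𝓕 (sobolevLift hs hmem.toLp) : L²) =ᵐ[volume] (𝓕 f : L²)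
  filter_upwards [coeFn_fourier_sobolevLift hs hmem.toLp, hmem.coeFn_toLp] with ξ hlift hξ
  rw [hlift, hξ, ← mul_assoc, mul_comm (sobolevWeight (-s) ξ), sobolevWeight_mul_neg, one_mul]

lemma evolutionL2_zero (f : L²) : evolutionL2 0 f = f := by
  have h : (memLp_symbol_mul 0 (𝓕 f)).toLp = (𝓕 f : L²) := by
    refine Lp.ext ?_
    filter_upwards [(memLp_symbol_mul 0 (𝓕 f)).coeFn_toLp] with ξ hξ
    rw [hξ]
    simp [symbol]
  rw [evolutionL2, h, fourierInv_fourier_eq]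

lemma norm_evolution_le_of_maximalFunction_le {f : 𝓢(ℝⁿ, ℂ)} {x : ℝⁿ} {r : ℝ≥0}
    (h : maximalFunction f x ≤ r) {t : ℝ} (ht : t ∈ Set.Icc (0 : ℝ) 1) :
    ‖evolution t f x‖ ≤ r := by
  have hIoo : Set.Ioo (0 : ℝ) 1 ⊆ {t | ‖evolution t f x‖ ≤ r} := fun t ht => by
    have := (le_iSup₂_of_le t ht le_rfl).trans h
    rwa [enorm_eq_nnnorm, ENNReal.coe_le_coe] at this
  have hIcc := closure_minimal hIoo
    (isClosed_le (continuous_evolution_time f x).norm continuous_const)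
  rw [closure_Ioo zero_ne_one] at hIcc
  exact hIcc ht

lemma MaximalBounded.exists_weakL2Norm_ball_le {s : ℝ} (h : MaximalBounded n s) :
    ∃ C : ℝ≥0, ∀ (f : 𝓢(ℝⁿ, ℂ)) (a : ℝⁿ),
      weakL2Norm (maximalFunction f) (volume.restrict (Metric.ball a 1)) ≤
        C * ‖sobolevEmb s f‖ₑ := by
  obtain ⟨C, hC⟩ := h
  refine ⟨C, fun f a => ?_⟩
  have hpres : MeasurePreserving (· + a) (volume.restrict (Metric.ball (0 : ℝⁿ) 1))
      (volume.restrict (Metric.ball a 1)) := by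
    simpa using (measurePreserving_add_right volume a).restrict_preimage
      (measurableSet_ball (x := a) (ε := 1))
  have hcomp : maximalFunction f ∘ (· + a) =
      maximalFunction (SchwartzMap.compSubConstCLM ℂ (-a) f) := by
    ext x
    simp [maximalFunction, evolution_compSubConstCLM]
  have hmeas : Measurable (maximalFunction f) := by
    rw [maximalFunction_eq_localMaximal]
    exact (lowerSemicontinuous_localMaximal 1 f).measurable
  rw [← weakL2Norm_comp hpres hmeas, hcomp]
  refine (hC _).trans_eq ?_
  rw [sobolevNorm_toLp, ← ofReal_norm, norm_sobolevEmb_compSubConstCLM, ofReal_norm]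

lemma MaximalBounded.ae_eventually_norm_evolution_le {s : ℝ} (h : MaximalBounded n s)
    {ψ : ℕ → 𝓢(ℝⁿ, ℂ)} (hψ : ∀ k, ‖sobolevEmb s (ψ k)‖ ≤ 4⁻¹ ^ k) :
    ∀ᵐ x, ∀ᶠ k in atTop, ∀ t ∈ Set.Icc (0 : ℝ) 1, ‖evolution t (ψ k) x‖ ≤ 2⁻¹ ^ k := by
  obtain ⟨C, hC⟩ := h.exists_weakL2Norm_ball_le
  refine ae_of_forall_ae_restrict_ball one_pos fun a => ?_
  have hweak (k : ℕ) : weakL2Norm (maximalFunction (ψ k)) (volume.restrict (Metric.ball a 1)) ≤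
      C * 4⁻¹ ^ k := by
    refine (hC (ψ k) a).trans (mul_le_mul_right (?_ : _ ≤ _) _)
    rw [← ofReal_norm]
    refine (ENNReal.ofReal_le_ofReal (hψ k)).trans_eq ?_
    rw [ENNReal.ofReal_pow (by norm_num), ENNReal.ofReal_inv_of_pos four_pos,
      ENNReal.ofReal_ofNat]
  filter_upwards [ae_eventually_le_of_weakL2Norm_le hweak] with x hx
  filter_upwards [hx] with k hk t ht
  simpa using norm_evolution_le_of_maximalFunction_le hk ht

theorem MaximalBounded.convergesAEOnSobolev {s : ℝ} (hs : 0 ≤ s) (h : MaximalBounded n s) :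
    ConvergesAEOnSobolev n s := by
  intro f hf
  obtain ⟨g, rfl⟩ := exists_sobolevLift_eq hs hf
  obtain ⟨φ, hφ, hdist⟩ := exists_seq_tendsto_and_dist_succ_le (denseRange_sobolevEmb s) g
    (r := 4⁻¹) (by norm_num) (by norm_num)
  let u (x : ℝⁿ) (t : ℝ) : ℂ := limUnder atTop fun k => evolution t (φ k) x
  have hunif : ∀ᵐ x, TendstoUniformlyOn (fun k t => evolution t (φ k) x) (u x) atTop
      (Set.Icc 0 1) := by
    filter_upwards [h.ae_eventually_norm_evolution_le (ψ := fun k => φ (k + 1) - φ k)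
      fun k => by simpa only [map_sub, ← dist_eq_norm] using hdist k] with x hx
    refine tendstoUniformlyOn_limUnder_of_dist_le_geometric (r := 2⁻¹) (by norm_num)
      (by norm_num) (hx.mono fun k hk t ht => ?_)
    rw [dist_comm, dist_eq_norm, ← evolution_sub]
    exact hk t ht
  have hu (t : ℝ) (ht : t ∈ Set.Icc (0 : ℝ) 1) :
      (fun x => u x t) =ᵐ[volume] evolutionL2 t (sobolevLift hs g) := by
    rw [← evolutionL2CLM_apply]
    refine ae_eq_of_tendsto_Lp_of_tendsto_ae
      (((evolutionL2CLM t ∘L sobolevLift hs).continuous.tendsto g).comp hφ) ?_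
    have hk : ∀ᵐ x, ∀ k, evolutionL2CLM t (sobolevLift hs (sobolevEmb s (φ k))) x =
        evolution t (φ k) x := ae_all_iff.2 fun k => by
      rw [sobolevLift_sobolevEmb, evolutionL2CLM_apply]
      exact coeFn_evolutionL2_toLp t (φ k)
    filter_upwards [hunif, hk] with x hx hxk
    exact (hx.tendsto_at ht).congr fun k => (hxk k).symm
  refine ⟨u, fun t ht => hu t (Set.Ioo_subset_Icc_self ht), ?_⟩
  have hu0 := hu 0 (Set.left_mem_Icc.2 zero_le_one)
  rw [evolutionL2_zero] at hu0
  filter_upwards [hunif, hu0] with x hx hx0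
  have hcont : ContinuousOn (u x) (Set.Icc 0 1) :=
    hx.continuousOn (.of_forall fun k => (continuous_evolution_time (φ k) x).continuousOn)
  rw [← hx0, ← nhdsWithin_Ioo_eq_nhdsGT one_pos]
  exact (hcont 0 (Set.left_mem_Icc.2 zero_le_one)).mono_left
    (nhdsWithin_mono 0 Set.Ioo_subset_Icc_self)

/-! ### Frequency bumps with aligned phases -/

/-- At the point `x` and the time `t`, the plane waves with frequencies in `A` all have phases
within `π / 3` of a common value. Phases are measured in units of `2π`. -/
def PhasesAligned (x : ℝⁿ) (t : ℝ) (A : Set ℝⁿ) : Prop :=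
  ∃ c : ℝ, ∀ ξ ∈ A, ∃ k : ℤ, |inner ℝ x ξ + 2 * Real.pi * t * ‖ξ‖ ^ 2 - c - k| ≤ 1 / 6

lemma PhasesAligned.mono {x : ℝⁿ} {t : ℝ} {A B : Set ℝⁿ} (h : PhasesAligned x t B) (hAB : A ⊆ B) :
    PhasesAligned x t A :=
  let ⟨c, hc⟩ := h
  ⟨c, fun ξ hξ => hc ξ (hAB hξ)⟩

lemma half_le_cos_of_abs_sub_intCast_le {θ : ℝ} {k : ℤ} (h : |θ - k| ≤ 1 / 6) :
    1 / 2 ≤ Real.cos (2 * Real.pi * θ) := by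
  have hθ : 2 * Real.pi * θ - k * (2 * Real.pi) = 2 * Real.pi * (θ - k) := by ring
  rw [← Real.cos_sub_int_mul_two_pi _ k, hθ, ← Real.cos_abs, abs_mul, abs_of_pos Real.two_pi_pos,
    ← Real.cos_pi_div_three]
  refine Real.cos_le_cos_of_nonneg_of_le_pi (by positivity) (by linarith [Real.pi_pos]) ?_
  nlinarith [Real.pi_pos]

lemma half_integral_le_norm_integral_exp_mul {α : Type*} [MeasurableSpace α] {μ : Measure α}
    {θ H : α → ℝ} (hθ : AEStronglyMeasurable θ μ) (hH : Integrable H μ) (hH₀ : ∀ a, 0 ≤ H a)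
    (h : ∀ a ∈ Function.support H, ∃ k : ℤ, |θ a - k| ≤ 1 / 6) :
    1 / 2 * ∫ a, H a ∂μ ≤
      ‖∫ a, Complex.exp ((2 * Real.pi * θ a : ℝ) * Complex.I) * (H a : ℂ) ∂μ‖ := by
  have hexp : AEStronglyMeasurable
      (fun a => Complex.exp ((2 * Real.pi * θ a : ℝ) * Complex.I)) μ :=
    (by fun_prop : Continuous fun y : ℝ => Complex.exp ((2 * Real.pi * y : ℝ) * Complex.I))
      |>.comp_aestronglyMeasurable hθ
  have hintegrable : Integrable
      (fun a => Complex.exp ((2 * Real.pi * θ a : ℝ) * Complex.I) * (H a : ℂ)) μ :=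
    hH.ofReal.bdd_mul (c := 1) hexp
      (Eventually.of_forall fun a => (Complex.norm_exp_ofReal_mul_I _).le)
  refine le_trans ?_ (Complex.re_le_norm _)
  rw [← integral_const_mul, ← RCLike.re_eq_complex_re, ← integral_re hintegrable]
  refine integral_mono (hH.const_mul _) hintegrable.re fun a => ?_
  simp only [RCLike.re_eq_complex_re, Complex.re_mul_ofReal, Complex.exp_ofReal_mul_I_re]
  by_cases ha : H a = 0
  · simp [ha]
  · obtain ⟨k, hk⟩ := h a ha
    exact mul_le_mul_of_nonneg_right (half_le_cos_of_abs_sub_intCast_le hk) (hH₀ a)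

lemma integrable_of_fourier_eq_ofReal {f : 𝓢(ℝⁿ, ℂ)} {H : ℝⁿ → ℝ}
    (hfH : ∀ ξ, 𝓕 f ξ = (H ξ : ℂ)) : Integrable H := by
  have hre : H = fun ξ => (𝓕 f ξ).re := funext fun ξ => by rw [hfH, Complex.ofReal_re]
  rw [hre]
  exact (𝓕 f).integrable.re

lemma PhasesAligned.half_integral_le_norm_evolution {f : 𝓢(ℝⁿ, ℂ)} {H : ℝⁿ → ℝ}
    (hfH : ∀ ξ, 𝓕 f ξ = (H ξ : ℂ)) (hH₀ : ∀ ξ, 0 ≤ H ξ) {t : ℝ} {x : ℝⁿ}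
    (h : PhasesAligned x t (Function.support H)) : 1 / 2 * ∫ ξ, H ξ ≤ ‖evolution t f x‖ := by
  obtain ⟨c, hc⟩ := h
  have hrotate : Complex.exp ((-(2 * Real.pi * c) : ℝ) * Complex.I) * evolution t f x =
      ∫ ξ, Complex.exp ((2 * Real.pi * (inner ℝ x ξ + 2 * Real.pi * t * ‖ξ‖ ^ 2 - c) : ℝ) *
        Complex.I) * (H ξ : ℂ) := by
    rw [evolution, ← integral_const_mul]
    refine integral_congr_ae (Eventually.of_forall fun ξ => ?_)
    simp only [hfH, symbol]
    rw [← mul_assoc, ← mul_assoc, ← Complex.exp_add, ← Complex.exp_add]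
    congr 2
    push_cast
    ring
  have hnorm := congrArg norm hrotate
  rw [norm_mul, Complex.norm_exp_ofReal_mul_I, one_mul] at hnorm
  rw [hnorm]
  exact half_integral_le_norm_integral_exp_mul (by fun_prop)
    (integrable_of_fourier_eq_ofReal hfH) hH₀ hc

lemma sobolevNorm_toLp_sq_le {s R : ℝ} (hs : 0 ≤ s) {f : 𝓢(ℝⁿ, ℂ)} {H : ℝⁿ → ℝ}
    (hfH : ∀ ξ, 𝓕 f ξ = (H ξ : ℂ)) (hH₀ : ∀ ξ, 0 ≤ H ξ) (hH₁ : ∀ ξ, H ξ ≤ 1)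
    (hHR : ∀ ξ ∈ Function.support H, ‖ξ‖ ≤ R) :
    sobolevNorm s (f.toLp 2) ^ 2 ≤
      ENNReal.ofReal ((1 + (2 * Real.pi * R) ^ 2) ^ s * ∫ ξ, H ξ) := by
  rw [sobolevNorm, ← ENNReal.rpow_natCast, ← ENNReal.rpow_mul, SchwartzMap.toLp_fourier_eq,
    show (1 / 2 : ℝ) * (2 : ℕ) = 1 by norm_num, ENNReal.rpow_one,
    ENNReal.ofReal_mul (by positivity), ofReal_integral_eq_lintegral_ofReal
      (integrable_of_fourier_eq_ofReal hfH) (Eventually.of_forall hH₀),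
    ← lintegral_const_mul' _ _ ENNReal.ofReal_ne_top]
  refine lintegral_mono_ae ?_
  filter_upwards [SchwartzMap.coeFn_toLp (𝓕 f) 2 volume] with ξ hξ
  rw [hξ, hfH]
  by_cases h0 : H ξ = 0
  · simp [h0]
  have hξR : ‖ξ‖ ≤ R := hHR ξ h0
  refine mul_le_mul' (ENNReal.ofReal_le_ofReal (by gcongr)) ?_
  rw [← ofReal_norm, Complex.norm_real, Real.norm_of_nonneg (hH₀ ξ), ← ENNReal.ofReal_pow (hH₀ ξ)]
  exact ENNReal.ofReal_le_ofReal (pow_le_of_le_one (hH₀ ξ) (hH₁ ξ) two_ne_zero)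

section BumpSum

variable {V : Type*} [NormedAddCommGroup V] [NormedSpace ℝ V] [HasContDiffBump V]

/-- The sum of the copies of a bump function centred at the frequencies in `Λ`. -/
def bumpSum (b : ContDiffBump (0 : V)) (Λ : Finset V) (ξ : V) : ℝ :=
  ∑ η ∈ Λ, b (ξ - η)

lemma bumpSum_nonneg (b : ContDiffBump (0 : V)) (Λ : Finset V) (ξ : V) : 0 ≤ bumpSum b Λ ξ :=
  Finset.sum_nonneg fun _ _ => b.nonneg

lemma dist_lt_rOut_of_ne_zero {b : ContDiffBump (0 : V)} {ξ η : V} (h : b (ξ - η) ≠ 0) :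
    dist ξ η < b.rOut := by
  have hmem : ξ - η ∈ Function.support b := h
  rwa [b.support_eq, mem_ball_zero_iff, ← dist_eq_norm] at hmem

lemma support_bumpSum_subset (b : ContDiffBump (0 : V)) (Λ : Finset V) :
    Function.support (bumpSum b Λ) ⊆ Metric.thickening b.rOut Λ := by
  intro ξ hξ
  obtain ⟨η, hη, hne⟩ := Finset.exists_ne_zero_of_sum_ne_zero hξ
  exact Metric.mem_thickening_iff.2 ⟨η, hη, dist_lt_rOut_of_ne_zero hne⟩

lemma bumpSum_le_one {b : ContDiffBump (0 : V)} {Λ : Finset V}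
    (hsep : (Λ : Set V).Pairwise fun η η' => 2 * b.rOut ≤ dist η η') (ξ : V) :
    bumpSum b Λ ξ ≤ 1 := by
  by_cases hne : bumpSum b Λ ξ = 0
  · rw [hne]
    exact zero_le_one
  obtain ⟨η, hη, hξη⟩ := Finset.exists_ne_zero_of_sum_ne_zero hne
  have hothers : ∀ η' ∈ Λ, η' ≠ η → b (ξ - η') = 0 := by
    intro η' hη' hne'
    by_contra hξη'
    linarith [hsep hη' hη hne', dist_triangle_left η' η ξ, dist_lt_rOut_of_ne_zero hξη,
      dist_lt_rOut_of_ne_zero hξη']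
  rw [bumpSum, Finset.sum_eq_single_of_mem η hη hothers]
  exact b.le_one

lemma integral_bumpSum [MeasurableSpace V] [BorelSpace V] [FiniteDimensional ℝ V]
    {μ : Measure V} [IsLocallyFiniteMeasure μ] [μ.IsAddRightInvariant]
    (b : ContDiffBump (0 : V)) (Λ : Finset V) :
    ∫ ξ, bumpSum b Λ ξ ∂μ = Λ.card * ∫ ξ, b ξ ∂μ := by
  simp only [bumpSum]
  rw [integral_finsetSum _ fun η _ => b.integrable.comp_sub_right η]
  simp only [integral_sub_right_eq_self (fun ξ => b ξ), Finset.sum_const, nsmul_eq_mul]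

end BumpSum

lemma exists_fourier_eq_bumpSum (b : ContDiffBump (0 : ℝⁿ)) (Λ : Finset ℝⁿ) :
    ∃ f : 𝓢(ℝⁿ, ℂ), ∀ ξ, 𝓕 f ξ = (bumpSum b Λ ξ : ℂ) := by
  have hb : HasCompactSupport fun ξ => ((b ξ : ℝ) : ℂ) :=
    b.hasCompactSupport.comp_left Complex.ofReal_zero
  let ψ : 𝓢(ℝⁿ, ℂ) := hb.toSchwartzMap (Complex.ofRealCLM.contDiff.comp b.contDiff)
  have hψ : ∀ ξ, ψ ξ = (b ξ : ℂ) := fun _ => rfl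
  refine ⟨𝓕⁻ (∑ η ∈ Λ, SchwartzMap.compSubConstCLM ℂ η ψ), fun ξ => ?_⟩
  rw [FourierTransform.fourier_fourierInv_eq, sum_apply, bumpSum, Complex.ofReal_sum]
  exact Finset.sum_congr rfl fun η _ => by rw [SchwartzMap.compSubConstCLM_apply, hψ]

lemma sq_mul_volume_le_of_weakL2Norm_le {α : Type*} [MeasurableSpace α] {μ : Measure α}
    {g : α → ℝ≥0∞} {B S : Set α} {C : ℝ≥0∞} {r : ℝ≥0} (h : weakL2Norm g (μ.restrict B) ≤ C)
    (hSB : S ⊆ B) (hS : ∀ x ∈ S, r < g x) : (r : ℝ≥0∞) ^ 2 * μ S ≤ C ^ 2 := by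
  refine le_trans ?_ (weakL2Norm_le_iff.1 h r)
  rw [← Measure.restrict_eq_self μ hSB]
  gcongr
  exact hS

lemma MaximalBounded.exists_card_mul_volume_le {s : ℝ} (h : MaximalBounded n s) (hs : 0 ≤ s)
    (b : ContDiffBump (0 : ℝⁿ)) :
    ∃ C : ℝ, ∀ (Λ : Finset ℝⁿ) (R : ℝ) (S : Set ℝⁿ),
      (Λ : Set ℝⁿ).Pairwise (fun η η' => 2 * b.rOut ≤ dist η η') →
      (∀ ξ ∈ Metric.thickening b.rOut (Λ : Set ℝⁿ), ‖ξ‖ ≤ R) → S ⊆ Metric.ball 0 1 →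
      (∀ x ∈ S, ∃ t ∈ Set.Ioo (0 : ℝ) 1, PhasesAligned x t (Metric.thickening b.rOut Λ)) →
      Λ.card * volume.real S ≤ C * (1 + (2 * Real.pi * R) ^ 2) ^ s := by
  obtain ⟨C, hC⟩ := h
  set I := ∫ ξ, b ξ
  have hI : 0 < I := b.integral_pos
  refine ⟨16 * C ^ 2 / I, fun Λ R S hsep hR hS hphase => ?_⟩
  rcases Λ.eq_empty_or_nonempty with rfl | hΛ
  · simp only [Finset.card_empty, Nat.cast_zero, zero_mul]
    positivity
  have hΛI : 0 < Λ.card * I := mul_pos (Nat.cast_pos.2 hΛ.card_pos) hI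
  obtain ⟨f, hf⟩ := exists_fourier_eq_bumpSum b Λ
  set r : ℝ≥0 := (Λ.card * I / 4).toNNReal
  have hr : (r : ℝ) = Λ.card * I / 4 := Real.coe_toNNReal _ (by positivity)
  have hlarge : ∀ x ∈ S, r < maximalFunction f x := by
    intro x hx
    obtain ⟨t, ht, halign⟩ := hphase x hx
    have hevol := (halign.mono (support_bumpSum_subset b Λ)).half_integral_le_norm_evolution hf
      (bumpSum_nonneg b Λ)
    rw [integral_bumpSum] at hevol
    refine lt_localMaximal_iff.2 ⟨t, ht, ?_⟩
    rw [enorm_eq_nnnorm, ENNReal.coe_lt_coe, ← NNReal.coe_lt_coe, hr, coe_nnnorm]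
    linarith
  have hnorm := sobolevNorm_toLp_sq_le hs hf (bumpSum_nonneg b Λ) (bumpSum_le_one hsep)
    fun ξ hξ => hR ξ (support_bumpSum_subset b Λ hξ)
  have hweak := sq_mul_volume_le_of_weakL2Norm_le (hC f) hS hlarge
  rw [mul_pow] at hweak
  have hreal := ENNReal.toReal_mono (by finiteness) (hweak.trans (mul_le_mul_right hnorm _))
  rw [integral_bumpSum, ENNReal.toReal_mul, ENNReal.toReal_mul, ENNReal.toReal_pow,
    ENNReal.toReal_pow, ENNReal.coe_toReal, ENNReal.coe_toReal,
    ENNReal.toReal_ofReal (by positivity), hr] at hreal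
  rw [div_mul_eq_mul_div, le_div_iff₀ hI]
  refine le_of_mul_le_mul_left ?_ (show 0 < Λ.card * I / 16 by positivity)
  calc Λ.card * I / 16 * (Λ.card * volume.real S * I)
      = (Λ.card * I / 4) ^ 2 * volume.real S := by ring
    _ ≤ C ^ 2 * ((1 + (2 * Real.pi * R) ^ 2) ^ s * (Λ.card * I)) := hreal
    _ = Λ.card * I / 16 * (16 * C ^ 2 * (1 + (2 * Real.pi * R) ^ 2) ^ s) := by ring

/-! ### Simultaneous approximation -/

lemma exists_abs_add_div_sub_intCast_le {m : ℕ} (hm : 0 < m) (z : ℝ) :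
    ∃ c < m, ∃ a : ℤ, |z + (c : ℝ) / m - a| ≤ 1 / m := by
  have hm' : (0 : ℝ) < m := Nat.cast_pos.2 hm
  set c := ⌊(⌈z⌉ - z) * m⌋₊
  have hle : (c : ℝ) ≤ (⌈z⌉ - z) * m :=
    Nat.floor_le (mul_nonneg (sub_nonneg.2 (Int.le_ceil z)) hm'.le)
  have hlt : (⌈z⌉ - z) * m < c + 1 := Nat.lt_floor_add_one _
  have hcm : (c : ℝ) < m := hle.trans_lt (by nlinarith [Int.ceil_lt_add_one z])
  have hdiff : z + (c : ℝ) / m - ⌈z⌉ = (c - (⌈z⌉ - z) * m) / m := by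
    field_simp
    ring
  refine ⟨c, by exact_mod_cast hcm, ⌈z⌉, ?_⟩
  rw [hdiff, abs_div, abs_of_pos hm']
  gcongr
  rw [abs_le]
  constructor <;> linarith

/- The base-`m` digits of `j - ⌈X⌉` are chosen one after the other: adding a multiple of `m ^ d`
changes the first `d` of the fractions `j / m ^ (i + 1)` by integers. -/
lemma exists_simultaneous_approx {m : ℕ} (hm : 0 < m) {d : ℕ} (y : Fin d → ℝ) {X : ℝ}
    (hX : 0 ≤ X) :
    ∃ j : ℕ, X ≤ j ∧ j < X + (m : ℝ) ^ d ∧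
      ∀ i : Fin d, ∃ a : ℤ, |y i + j / (m : ℝ) ^ (i + 1 : ℕ) - a| ≤ 1 / m := by
  induction d with
  | zero => exact ⟨⌈X⌉₊, Nat.le_ceil X, by simpa using Nat.ceil_lt_add_one hX, by simp⟩
  | succ d ih =>
    obtain ⟨j, hXj, hjX, hj⟩ := ih fun i => y i.castSucc
    obtain ⟨c, hcm, a, ha⟩ :=
      exists_abs_add_div_sub_intCast_le hm (y (Fin.last d) + j / (m : ℝ) ^ (d + 1))
    have hcm' : ((c : ℝ) + 1) * (m : ℝ) ^ d ≤ (m : ℝ) ^ (d + 1) := by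
      rw [pow_succ']
      gcongr
      exact_mod_cast hcm
    refine ⟨j + c * m ^ d, ?_, ?_, fun i => ?_⟩
    · push_cast
      linarith [show (0 : ℝ) ≤ c * (m : ℝ) ^ d by positivity]
    · push_cast
      linarith
    induction i using Fin.lastCases with
    | last =>
      refine ⟨a, le_of_eq_of_le ?_ ha⟩
      congr 1
      rw [Fin.val_last]
      push_cast
      field_simp
      ring
    | cast i =>
      obtain ⟨a, ha⟩ := hj i
      have hpow : (m : ℝ) ^ d = m ^ (d - (i + 1)) * m ^ (i + 1 : ℕ) := by
        rw [← pow_add, Nat.sub_add_cancel i.2]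
      refine ⟨a + c * m ^ (d - (i + 1)), le_of_eq_of_le ?_ ha⟩
      congr 1
      rw [Fin.val_castSucc]
      push_cast
      rw [hpow]
      field_simp
      ring

/-! ### A lattice of frequencies -/

/-- The frequency `(m ^ (2d+4) + l, θ + m ^ (2d+3) k)` with `θ i = m ^ (2d+4) / (2 m ^ (i+2))`,
where `l` is the position along the first axis and `k` the position in the transverse lattice. -/
def latticeFreq (d m l : ℕ) (k : Fin d → ℕ) : EuclideanSpace ℝ (Fin (d + 1)) :=
  WithLp.toLp 2 (Fin.cons ((m : ℝ) ^ (2 * d + 4) + l) fun i : Fin d =>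
    (m : ℝ) ^ (2 * d + 4) / (2 * (m : ℝ) ^ (i + 2 : ℕ)) + (m : ℝ) ^ (2 * d + 3) * k i)

lemma latticeFreq_apply_zero (d m l : ℕ) (k : Fin d → ℕ) :
    latticeFreq d m l k 0 = (m : ℝ) ^ (2 * d + 4) + l := rfl

lemma latticeFreq_apply_succ (d m l : ℕ) (k : Fin d → ℕ) (i : Fin d) :
    latticeFreq d m l k i.succ =
      (m : ℝ) ^ (2 * d + 4) / (2 * (m : ℝ) ^ (i + 2 : ℕ)) + (m : ℝ) ^ (2 * d + 3) * k i := rfl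

lemma one_le_dist_latticeFreq {d m l l' : ℕ} {k k' : Fin d → ℕ} (hm : 0 < m)
    (h : ¬ (l = l' ∧ k = k')) : 1 ≤ dist (latticeFreq d m l k) (latticeFreq d m l' k') := by
  have hcoord (i : Fin (d + 1)) : |latticeFreq d m l k i - latticeFreq d m l' k' i| ≤
      dist (latticeFreq d m l k) (latticeFreq d m l' k') := by
    rw [dist_eq_norm]
    exact PiLp.norm_apply_le (latticeFreq d m l k - latticeFreq d m l' k') i
  have hnat (a b : ℕ) (hab : a ≠ b) : (1 : ℝ) ≤ |(a : ℝ) - b| := by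
    exact_mod_cast Int.one_le_abs (sub_ne_zero.2 (Nat.cast_injective.ne hab : (a : ℤ) ≠ b))
  by_cases hl : l = l'
  · obtain ⟨i, hi⟩ := Function.ne_iff.1 fun hk => h ⟨hl, hk⟩
    refine le_trans ?_ (hcoord i.succ)
    rw [latticeFreq_apply_succ, latticeFreq_apply_succ, add_sub_add_left_eq_sub, ← mul_sub,
      abs_mul, abs_of_nonneg (by positivity)]
    exact one_le_mul_of_one_le_of_one_le (one_le_pow₀ (by exact_mod_cast hm)) (hnat _ _ hi)
  · refine le_trans ?_ (hcoord 0)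
    rw [latticeFreq_apply_zero, latticeFreq_apply_zero, add_sub_add_left_eq_sub]
    exact hnat _ _ hl

lemma abs_latticeFreq_apply_le {d m l : ℕ} {k : Fin d → ℕ} (hm : 0 < m) (hl : l ≤ m ^ (d + 2))
    (hk : ∀ i, k i ≤ m) (i : Fin (d + 1)) :
    |latticeFreq d m l k i| ≤ 2 * (m : ℝ) ^ (2 * d + 4) := by
  have hm₁ : (1 : ℝ) ≤ m := by exact_mod_cast hm
  induction i using Fin.cases with
  | zero =>
    have hl' : (l : ℝ) ≤ (m : ℝ) ^ (2 * d + 4) := by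
      exact_mod_cast hl.trans (Nat.pow_le_pow_right hm (by omega))
    rw [latticeFreq_apply_zero, abs_of_nonneg (by positivity)]
    linarith
  | succ i =>
    have hshift : (m : ℝ) ^ (2 * d + 4) / (2 * (m : ℝ) ^ (i + 2 : ℕ)) ≤ (m : ℝ) ^ (2 * d + 4) :=
      div_le_self (by positivity) (by linarith [one_le_pow₀ hm₁ (n := (i + 2 : ℕ))])
    have hlattice : (m : ℝ) ^ (2 * d + 3) * k i ≤ (m : ℝ) ^ (2 * d + 4) := by
      rw [pow_succ _ (2 * d + 3)]
      gcongr
      exact hk i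
    rw [latticeFreq_apply_succ, abs_of_nonneg (by positivity)]
    linarith

lemma norm_latticeFreq_le {d m l : ℕ} {k : Fin d → ℕ} (hm : 0 < m) (hl : l ≤ m ^ (d + 2))
    (hk : ∀ i, k i ≤ m) : ‖latticeFreq d m l k‖ ≤ (d + 1) * (2 * (m : ℝ) ^ (2 * d + 4)) := by
  have hsup := (EuclideanSpace.basisFun (Fin (d + 1)) ℝ).norm_le_card_mul_iSup_norm_inner
    (latticeFreq d m l k)
  simp only [EuclideanSpace.basisFun_inner, Fintype.card_fin, Nat.cast_add_one] at hsup
  refine hsup.trans (mul_le_mul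
    (Real.sqrt_le_self_iff.2 (Or.inr (by linarith [d.cast_nonneg (α := ℝ)])))
    (Real.iSup_le (abs_latticeFreq_apply_le hm hl hk) (by positivity))
    (Real.iSup_nonneg fun i => norm_nonneg _) (by positivity))

/-- The lattice frequencies `latticeFreq d m l k` with `l < p ^ (d + 2)` and all `k i < p`. -/
def latticeFreqs (d m p : ℕ) : Finset (EuclideanSpace ℝ (Fin (d + 1))) :=
  open Classical in
  (Finset.range (p ^ (d + 2)) ×ˢ Fintype.piFinset fun _ : Fin d => Finset.range p).image
    fun a => latticeFreq d m a.1 a.2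

lemma mem_latticeFreqs {d m p : ℕ} {η : EuclideanSpace ℝ (Fin (d + 1))} :
    η ∈ latticeFreqs d m p ↔
      ∃ l < p ^ (d + 2), ∃ k : Fin d → ℕ, (∀ i, k i < p) ∧ latticeFreq d m l k = η := by
  simp only [latticeFreqs, Finset.mem_image, Finset.mem_product, Finset.mem_range,
    Fintype.mem_piFinset, Prod.exists]
  exact ⟨fun ⟨l, k, ⟨hl, hk⟩, h⟩ => ⟨l, hl, k, hk, h⟩, fun ⟨l, hl, k, hk, h⟩ => ⟨l, k, ⟨hl, hk⟩, h⟩⟩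

lemma card_latticeFreqs {d m : ℕ} (hm : 0 < m) (p : ℕ) :
    (latticeFreqs d m p).card = p ^ (2 * d + 2) := by
  classical
  have hinj : Function.Injective fun a : ℕ × (Fin d → ℕ) => latticeFreq d m a.1 a.2 := by
    intro a a' heq
    by_contra hne
    have hdist := one_le_dist_latticeFreq hm fun h => hne (Prod.ext h.1 h.2)
    rw [show latticeFreq d m a.1 a.2 = _ from heq, dist_self] at hdist
    linarith
  rw [latticeFreqs, Finset.card_image_of_injective _ hinj, Finset.card_product, Finset.card_range,
    Fintype.card_piFinset_const, Finset.card_range, ← pow_add]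
  congr 1
  omega

lemma pairwise_one_le_dist_latticeFreqs {d m p : ℕ} (hm : 0 < m) :
    (latticeFreqs d m p : Set (EuclideanSpace ℝ (Fin (d + 1)))).Pairwise
      fun η η' => 1 ≤ dist η η' := by
  intro η hη η' hη' hne
  obtain ⟨l, -, k, -, rfl⟩ := mem_latticeFreqs.1 hη
  obtain ⟨l', -, k', -, rfl⟩ := mem_latticeFreqs.1 hη'
  exact one_le_dist_latticeFreq hm fun ⟨hl, hk⟩ => hne (by rw [hl, hk])

lemma norm_le_of_mem_thickening_latticeFreqs {d m p : ℕ} {ρ : ℝ} (hm : 0 < m) (hpm : p ≤ m)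
    (hρ : ρ ≤ 1) {ξ : EuclideanSpace ℝ (Fin (d + 1))}
    (hξ : ξ ∈ Metric.thickening ρ (latticeFreqs d m p : Set (EuclideanSpace ℝ (Fin (d + 1))))) :
    ‖ξ‖ ≤ (2 * d + 3) * (m : ℝ) ^ (2 * d + 4) := by
  obtain ⟨η, hη, hξη⟩ := Metric.mem_thickening_iff.1 hξ
  obtain ⟨l, hl, k, hk, rfl⟩ := mem_latticeFreqs.1 hη
  have hη' := norm_latticeFreq_le hm (hl.le.trans (Nat.pow_le_pow_left hpm _))
    fun i => (hk i).le.trans hpm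
  have hpow : (1 : ℝ) ≤ (m : ℝ) ^ (2 * d + 4) := one_le_pow₀ (by exact_mod_cast hm)
  rw [dist_eq_norm] at hξη
  linarith [norm_le_norm_add_norm_sub' ξ (latticeFreq d m l k)]

/-! ### Alignment of the lattice phases -/

lemma PhasesAligned.of_apply {x : ℝⁿ} {τ : ℝ} {A : Set ℝⁿ} {c : Fin n → ℝ}
    (h : ∀ ξ ∈ A, ∃ k : Fin n → ℤ, ∑ i, |x i * ξ i + τ * ξ i ^ 2 - c i - k i| ≤ 1 / 6) :
    PhasesAligned x (τ / (2 * Real.pi)) A := by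
  refine ⟨∑ i, c i, fun ξ hξ => ?_⟩
  obtain ⟨k, hk⟩ := h ξ hξ
  refine ⟨∑ i, k i, le_trans (le_of_eq_of_le ?_ (Finset.abs_sum_le_sum_abs _ _)) hk⟩
  rw [mul_div_cancel₀ _ Real.two_pi_pos.ne', EuclideanSpace.real_norm_sq_eq, PiLp.inner_apply,
    Int.cast_sum, Finset.mul_sum, ← Finset.sum_add_distrib, ← Finset.sum_sub_distrib,
    ← Finset.sum_sub_distrib]
  simp only [RCLike.inner_apply, conj_trivial, mul_comm (x _)]

lemma abs_longitudinal_phase_le {M P q x τ R w : ℝ} (hM : 1 ≤ M) (hP : 0 ≤ P) (hq : 0 < q)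
    (hMP : M * P ≤ q) (hτ : 0 ≤ τ) (hτq : τ * q ^ 2 ≤ 1)
    (hx₀ : 0 ≤ x + 2 * τ * R) (hx₁ : x + 2 * τ * R ≤ 2 / q) (hw : |w| ≤ P) :
    |x * (R + w) + τ * (R + w) ^ 2 - (x * R + τ * R ^ 2)| ≤ 3 / M := by
  have hM₀ : 0 < M := by linarith
  have hPq : P / q ≤ 1 / M := by
    rw [div_le_div_iff₀ hq hM₀]
    linarith
  have hlinear : |(x + 2 * τ * R) * w| ≤ 2 / M := by
    rw [abs_mul, abs_of_nonneg hx₀]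
    calc (x + 2 * τ * R) * |w| ≤ 2 / q * P := by gcongr
      _ = 2 * (P / q) := by ring
      _ ≤ 2 * (1 / M) := by gcongr
      _ = 2 / M := by ring
  have hquadratic : |τ * w ^ 2| ≤ 1 / M := by
    rw [abs_mul, abs_of_nonneg hτ, abs_pow]
    calc τ * |w| ^ 2 ≤ 1 / q ^ 2 * P ^ 2 := by
          gcongr
          rwa [le_div_iff₀ (by positivity)]
      _ = P / q * (P / q) := by ring
      _ ≤ 1 / M * (1 / M) := by gcongr
      _ ≤ 1 / M := mul_le_of_le_one_right (by positivity) ((div_le_one hM₀).2 hM)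
  calc |x * (R + w) + τ * (R + w) ^ 2 - (x * R + τ * R ^ 2)|
      = |(x + 2 * τ * R) * w + τ * w ^ 2| := by ring_nf
    _ ≤ |(x + 2 * τ * R) * w| + |τ * w ^ 2| := abs_add_le _ _
    _ ≤ 2 / M + 1 / M := add_le_add hlinear hquadratic
    _ = 3 / M := by ring

lemma abs_transverse_phase_le {M m x τ A D k ζ a : ℝ} (hM : 1 ≤ M) (hm : 0 < m)
    (hk : 0 ≤ k) (hkm : M * k ≤ m) (hx : |x| ≤ 1) (hA₀ : 0 ≤ 2 * τ * A) (hA₁ : 2 * τ * A ≤ 1)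
    (ha : |D * (x + 2 * τ * A) - a| ≤ 1 / m) (hτ₀ : 0 ≤ τ) (hτ₁ : τ ≤ 1)
    (hD₀ : 0 ≤ τ * D * k) (hD₁ : τ * D * k ≤ 1) (hζ : |ζ| ≤ 1 / M) :
    |x * (A + D * k + ζ) + τ * (A + D * k + ζ) ^ 2 - (x * A + τ * A ^ 2) -
      (a * k + τ * D ^ 2 * k ^ 2)| ≤ 6 / M := by
  have hM₀ : 0 < M := by linarith
  have hresidue : |(D * (x + 2 * τ * A) - a) * k| ≤ 1 / M := by
    rw [abs_mul, abs_of_nonneg hk]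
    calc _ ≤ 1 / m * k := by gcongr
      _ ≤ 1 / M := by
        rw [one_div_mul_eq_div, div_le_div_iff₀ hm hM₀]
        linarith
  have hlinear : |(x + 2 * τ * A) * ζ| ≤ 2 * (1 / M) := by
    rw [abs_mul]
    have : |x + 2 * τ * A| ≤ 2 := by
      refine (abs_add_le _ _).trans ?_
      rw [abs_of_nonneg hA₀]
      linarith
    gcongr
  have hcross : |2 * (τ * D * k) * ζ| ≤ 2 * (1 / M) := by
    rw [abs_mul, abs_of_nonneg (by linarith)]
    gcongr
    linarith
  have hquadratic : |τ * ζ ^ 2| ≤ 1 / M := by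
    rw [abs_mul, abs_of_nonneg hτ₀, abs_pow]
    nlinarith [abs_nonneg ζ, (div_le_one hM₀).2 hM]
  calc _ = |(D * (x + 2 * τ * A) - a) * k + (x + 2 * τ * A) * ζ + 2 * (τ * D * k) * ζ +
          τ * ζ ^ 2| := by ring_nf
    _ ≤ |(D * (x + 2 * τ * A) - a) * k| + |(x + 2 * τ * A) * ζ| + |2 * (τ * D * k) * ζ| +
          |τ * ζ ^ 2| := by simpa only [Real.norm_eq_abs] using norm_add₄_le (E := ℝ)
    _ ≤ 1 / M + 2 * (1 / M) + 2 * (1 / M) + 1 / M := by gcongr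
    _ = 6 / M := by ring

/-- At the time `τ / (2π)`, the phases at `x` of the lattice frequencies of scale `m` are aligned:
`pos` and `mul_le_one` bound `τ`, the group velocity nearly cancels `x 0` on the first axis, and the
phase is linear with nearly integer slope plus an integer quadratic part on the transverse
lattice. -/
structure IsAlignmentTime (d m : ℕ) (x : EuclideanSpace ℝ (Fin (d + 1))) (τ : ℝ) : Prop where
  pos : 0 < τ
  mul_le_one : τ * (m : ℝ) ^ (2 * d + 4) ≤ 1
  drift_nonneg : 0 ≤ x 0 + 2 * τ * (m : ℝ) ^ (2 * d + 4)
  drift_le : x 0 + 2 * τ * (m : ℝ) ^ (2 * d + 4) ≤ 2 / (m : ℝ) ^ (d + 2)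
  exists_quadratic : ∃ j : ℤ, τ * ((m : ℝ) ^ (2 * d + 3)) ^ 2 = j
  exists_slope (i : Fin d) : ∃ a : ℤ, |(m : ℝ) ^ (2 * d + 3) * (x i.succ +
    2 * τ * ((m : ℝ) ^ (2 * d + 4) / (2 * (m : ℝ) ^ (i + 2 : ℕ)))) - a| ≤ 1 / m

/- With `D = m ^ (2d+3)` and `τ = j / D ^ 2`, the slopes are `D * x (i+1) + j / m ^ (i+1)` and the
drift is `2 m (j - X) / D` with `X = - x 0 * D / (2m)`, so the `m ^ d` consecutive candidates for
`j` starting at `X` keep the drift below `2 m ^ (d+1) / D`. -/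
lemma exists_isAlignmentTime {d m : ℕ} (hm : 2 ≤ m) {x : EuclideanSpace ℝ (Fin (d + 1))}
    (hx : -1 ≤ x 0) (hx₀ : x 0 < 0) : ∃ τ, IsAlignmentTime d m x τ := by
  have hm₂ : (2 : ℝ) ≤ m := by exact_mod_cast hm
  have hm₀ : (0 : ℝ) < m := by linarith
  set D : ℝ := (m : ℝ) ^ (2 * d + 3) with hD
  set q : ℝ := (m : ℝ) ^ (d + 2) with hq
  have hRD : (m : ℝ) ^ (2 * d + 4) = m * D := by rw [hD]; ring
  have hDq : D = q * m ^ (d + 1) := by rw [hD, hq]; ring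
  have hD₀ : 0 < D := by positivity
  have hq₂ : 2 ≤ q := hm₂.trans (le_self_pow₀ (by linarith) (by omega))
  set X : ℝ := -x 0 * D / (2 * m) with hX
  have hX₀ : 0 < X := by
    have : 0 < -x 0 := by linarith
    positivity
  obtain ⟨j, hXj, hjX, hj⟩ :=
    exists_simultaneous_approx (by omega : 0 < m) (fun i : Fin d => D * x i.succ) hX₀.le
  have hdrift : x 0 + 2 * (j / D ^ 2) * (m * D) = 2 * m * (j - X) / D := by
    rw [hX]
    field_simp
    ring
  have hdrift_le : x 0 + 2 * (j / D ^ 2) * (m * D) ≤ 2 / q := by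
    rw [hdrift, div_le_div_iff₀ hD₀ (by linarith), hDq]
    calc 2 * m * (j - X) * q ≤ 2 * m * m ^ d * q := by gcongr; linarith
      _ = 2 * (q * m ^ (d + 1)) := by ring
  have hτ₁ : j / D ^ 2 * (m * D) ≤ 1 := by linarith [(div_le_one (by linarith)).2 hq₂]
  refine ⟨j / D ^ 2, div_pos (hX₀.trans_le hXj) (by positivity), ?_, ?_, ?_, ⟨j, ?_⟩, fun i => ?_⟩
  · rwa [hRD]
  · rw [hRD, hdrift]
    exact div_nonneg (mul_nonneg (by positivity) (sub_nonneg.2 hXj)) hD₀.le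
  · rwa [hRD]
  · rw [Int.cast_natCast, ← hD, div_mul_cancel₀ _ (by positivity)]
  · obtain ⟨a, ha⟩ := hj i
    refine ⟨a, le_of_eq_of_le ?_ ha⟩
    rw [hRD, ← hD]
    congr 2
    field_simp
    ring

section IsAlignmentTime

variable {d M p : ℕ} {x : EuclideanSpace ℝ (Fin (d + 1))} {τ : ℝ}

lemma IsAlignmentTime.le_one {m : ℕ} (h : IsAlignmentTime d m x τ) (hm : 0 < m) : τ ≤ 1 :=
  (le_mul_of_one_le_right h.pos.le (one_le_pow₀ (by exact_mod_cast hm))).trans h.mul_le_one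

lemma IsAlignmentTime.abs_longitudinal_le (h : IsAlignmentTime d (M * p) x τ) (hM : 1 ≤ M)
    (hp : 0 < p) {l : ℕ} (hl : l < p ^ (d + 2)) {ζ : ℝ} (hζ : |ζ| ≤ 1) (k : Fin d → ℕ) :
    |x 0 * (latticeFreq d (M * p) l k 0 + ζ) + τ * (latticeFreq d (M * p) l k 0 + ζ) ^ 2 -
      (x 0 * latticeFreq d (M * p) 0 0 0 + τ * latticeFreq d (M * p) 0 0 0 ^ 2)| ≤ 3 / M := by
  have hM' : (1 : ℝ) ≤ M := by exact_mod_cast hM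
  have hl' : (l : ℝ) + 1 ≤ (p : ℝ) ^ (d + 2) := by exact_mod_cast hl
  have hτ := h.mul_le_one
  simp only [latticeFreq_apply_zero, Nat.cast_zero, add_zero, add_assoc]
  refine abs_longitudinal_phase_le (P := (p : ℝ) ^ (d + 2)) hM' (by positivity)
    (by positivity) ?_ h.pos.le ?_ h.drift_nonneg h.drift_le ?_
  · rw [Nat.cast_mul, mul_pow]
    gcongr
    exact le_self_pow₀ hM' (by omega)
  · rwa [← pow_mul, show (d + 2) * 2 = 2 * d + 4 by ring]
  · calc |(l : ℝ) + ζ| ≤ |(l : ℝ)| + |ζ| := abs_add_le _ _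
      _ ≤ l + 1 := by
        rw [Nat.abs_cast]
        gcongr
      _ ≤ (p : ℝ) ^ (d + 2) := hl'

lemma IsAlignmentTime.exists_abs_transverse_le (h : IsAlignmentTime d (M * p) x τ) (hM : 1 ≤ M)
    (hp : 0 < p) (i : Fin d) (hx : |x i.succ| ≤ 1) {k : Fin d → ℕ} (hk : k i < p) {ζ : ℝ}
    (hζ : |ζ| ≤ 1 / M) (l : ℕ) :
    ∃ K : ℤ, |x i.succ * (latticeFreq d (M * p) l k i.succ + ζ) +
      τ * (latticeFreq d (M * p) l k i.succ + ζ) ^ 2 -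
      (x i.succ * latticeFreq d (M * p) 0 0 i.succ +
        τ * latticeFreq d (M * p) 0 0 i.succ ^ 2) - K| ≤ 6 / M := by
  obtain ⟨a, ha⟩ := h.exists_slope i
  obtain ⟨j, hj⟩ := h.exists_quadratic
  have hτ := h.pos
  have hM' : (1 : ℝ) ≤ M := by exact_mod_cast hM
  have hm : (1 : ℝ) ≤ (M * p : ℕ) := by exact_mod_cast Nat.mul_pos hM hp
  have hMk : (M : ℝ) * k i ≤ (M * p : ℕ) := by exact_mod_cast Nat.mul_le_mul_left M hk.le
  refine ⟨a * k i + j * (k i : ℤ) ^ 2, ?_⟩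
  simp only [latticeFreq_apply_succ, Pi.zero_apply, Nat.cast_zero, mul_zero, add_zero]
  simp only [Int.cast_add, Int.cast_mul, Int.cast_pow, Int.cast_natCast]
  rw [← hj]
  refine abs_transverse_phase_le hM' (by linarith) (by positivity) hMk hx (by positivity) ?_ ha
    hτ.le (h.le_one (Nat.mul_pos hM hp)) (by positivity) ?_ hζ
  · calc _ = τ * ((M * p : ℕ) : ℝ) ^ (2 * d + 4) / ((M * p : ℕ) : ℝ) ^ (i + 2 : ℕ) := by ring
      _ ≤ 1 := div_le_one_of_le₀ (h.mul_le_one.trans (one_le_pow₀ hm)) (by positivity)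
  · calc _ ≤ τ * ((M * p : ℕ) : ℝ) ^ (2 * d + 3) * (M * p : ℕ) := by
          gcongr
          exact_mod_cast (le_mul_of_one_le_left (Nat.cast_nonneg _) hM').trans hMk
      _ = τ * ((M * p : ℕ) : ℝ) ^ (2 * d + 4) := by ring
      _ ≤ 1 := h.mul_le_one

lemma IsAlignmentTime.phasesAligned (h : IsAlignmentTime d (M * p) x τ) (hM : 36 * (d + 1) ≤ M)
    (hp : 0 < p) (hx : ‖x‖ ≤ 1) : PhasesAligned x (τ / (2 * Real.pi))
      (Metric.thickening (1 / (M : ℝ)) (latticeFreqs d (M * p) p)) := by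
  have hM₁ : 1 ≤ M := by omega
  have hM' : (1 : ℝ) ≤ M := by exact_mod_cast hM₁
  have hx' (i) : |x i| ≤ 1 := (PiLp.norm_apply_le x i).trans hx
  refine .of_apply (c := fun i => x i * latticeFreq d (M * p) 0 0 i +
    τ * latticeFreq d (M * p) 0 0 i ^ 2) fun ξ hξ => ?_
  obtain ⟨η, hη, hξη⟩ := Metric.mem_thickening_iff.1 hξ
  obtain ⟨l, hl, k, hk, rfl⟩ := mem_latticeFreqs.1 hη
  obtain ⟨ζ, rfl⟩ : ∃ ζ, ξ = latticeFreq d (M * p) l k + ζ := ⟨_, (add_sub_cancel _ _).symm⟩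
  rw [dist_self_add_left] at hξη
  have hζ (i) : |ζ i| ≤ 1 / M := (PiLp.norm_apply_le ζ i).trans hξη.le
  have hlong := h.abs_longitudinal_le hM₁ hp hl ((hζ 0).trans ((div_le_one (by linarith)).2 hM')) k
  choose K hK using fun i => h.exists_abs_transverse_le hM₁ hp i (hx' _) (hk i) (hζ i.succ) l
  refine ⟨Fin.cons 0 K, ?_⟩
  simp only [Fin.sum_univ_succ, Fin.cons_zero, Fin.cons_succ, Int.cast_zero, sub_zero,
    PiLp.add_apply]
  calc _ ≤ 3 / (M : ℝ) + ∑ _i : Fin d, 6 / (M : ℝ) :=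
        add_le_add hlong (Finset.sum_le_sum fun i _ => hK i)
    _ = (3 + 6 * d) / M := by
        rw [Finset.sum_const, Finset.card_univ, Fintype.card_fin, nsmul_eq_mul]
        ring
    _ ≤ 1 / 6 := by
        have hM₃₆ : (36 : ℝ) * (d + 1) ≤ M := by exact_mod_cast hM
        rw [div_le_div_iff₀ (by linarith) (by norm_num)]
        linarith

end IsAlignmentTime

lemma exists_phasesAligned_latticeFreqs {d M p : ℕ} (hM : 36 * (d + 1) ≤ M) (hp : 0 < p)
    {x : EuclideanSpace ℝ (Fin (d + 1))} (hx : ‖x‖ ≤ 1) (hx₀ : x 0 < 0) :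
    ∃ t ∈ Set.Ioo (0 : ℝ) 1, PhasesAligned x t
      (Metric.thickening (1 / (M : ℝ)) (latticeFreqs d (M * p) p)) := by
  have hm : 2 ≤ M * p := by nlinarith
  obtain ⟨τ, hτ⟩ := exists_isAlignmentTime hm (abs_le.1 ((PiLp.norm_apply_le x 0).trans hx)).1 hx₀
  refine ⟨τ / (2 * Real.pi), ⟨div_pos hτ.pos Real.two_pi_pos, ?_⟩, hτ.phasesAligned hM hp hx⟩
  rw [div_lt_one Real.two_pi_pos]
  linarith [hτ.le_one (by omega), Real.pi_gt_three]

/-! ### Necessity of the exponent -/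

lemma exponent_le_of_pow_le_rpow {k : ℕ} {v C β : ℝ} (hv : 0 < v)
    (h : ∀ p : ℕ, 0 < p → (p : ℝ) ^ k * v ≤ C * (p : ℝ) ^ β) : (k : ℝ) ≤ β := by
  by_contra! hlt
  have hatTop : Tendsto (fun p : ℕ => (p : ℝ) ^ ((k : ℝ) - β)) atTop atTop :=
    (tendsto_rpow_atTop (sub_pos.2 hlt)).comp tendsto_natCast_atTop_atTop
  obtain ⟨p, hp, hlarge⟩ :=
    ((eventually_gt_atTop 0).and (hatTop.eventually_gt_atTop (C / v))).exists
  have hp' : (0 : ℝ) < p := by exact_mod_cast hp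
  rw [Real.rpow_sub hp', Real.rpow_natCast, div_lt_div_iff₀ hv (by positivity)] at hlarge
  exact (h p hp).not_gt hlarge

lemma volume_real_halfBall_pos (d : ℕ) :
    0 < volume.real (Metric.ball (0 : EuclideanSpace ℝ (Fin (d + 1))) 1 ∩ {x | x 0 < 0}) := by
  have hopen : IsOpen (Metric.ball (0 : EuclideanSpace ℝ (Fin (d + 1))) 1 ∩ {x | x 0 < 0}) :=
    Metric.isOpen_ball.inter (isOpen_lt (by fun_prop) continuous_const)
  refine ENNReal.toReal_pos (hopen.measure_pos volume
    ⟨EuclideanSpace.single 0 (-(1 / 2) : ℝ), ?_, ?_⟩).ne'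
    ((measure_mono Set.inter_subset_left).trans_lt measure_ball_lt_top).ne
  · rw [mem_ball_zero_iff, PiLp.norm_single]
    norm_num
  · simp

lemma one_add_mul_pow_sq_rpow_le {s p : ℝ} (hs : 0 ≤ s) (hp : 1 ≤ p) (W : ℝ) (k : ℕ) :
    (1 + (W * p ^ k) ^ 2) ^ s ≤ (1 + W ^ 2) ^ s * p ^ (2 * k * s) := by
  calc (1 + (W * p ^ k) ^ 2) ^ s ≤ ((1 + W ^ 2) * p ^ (2 * k)) ^ s := by
        gcongr
        linarith [one_le_pow₀ hp (n := 2 * k),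
          show (W * p ^ k) ^ 2 = W ^ 2 * p ^ (2 * k) by ring]
    _ = (1 + W ^ 2) ^ s * p ^ (2 * k * s) := by
        rw [Real.mul_rpow (by positivity) (by positivity), ← Real.rpow_natCast p,
          ← Real.rpow_mul (by linarith)]
        push_cast
        rfl

lemma MaximalBounded.exists_pow_mul_volume_halfBall_le {d : ℕ} {s : ℝ}
    (h : MaximalBounded (d + 1) s) (hs : 0 ≤ s) :
    ∃ C : ℝ, ∀ p : ℕ, 0 < p → (p : ℝ) ^ (2 * d + 2) *
      volume.real (Metric.ball (0 : EuclideanSpace ℝ (Fin (d + 1))) 1 ∩ {x | x 0 < 0}) ≤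
        C * (p : ℝ) ^ (2 * (2 * d + 4 : ℕ) * s) := by
  set M : ℕ := 36 * (d + 1)
  have hM₂ : (2 : ℝ) ≤ M := by exact_mod_cast (by omega : 2 ≤ M)
  let b : ContDiffBump (0 : EuclideanSpace ℝ (Fin (d + 1))) :=
    ⟨1 / (2 * M), 1 / M, by positivity, by gcongr; linarith⟩
  have hb : 2 * b.rOut ≤ 1 := by
    rw [show b.rOut = 1 / M from rfl, mul_one_div, div_le_one (by linarith)]
    exact hM₂
  obtain ⟨C, hC⟩ := h.exists_card_mul_volume_le hs b
  set W : ℝ := 2 * Real.pi * ((2 * d + 3) * (M : ℝ) ^ (2 * d + 4)) with hW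
  refine ⟨|C| * (1 + W ^ 2) ^ s, fun p hp => ?_⟩
  have hm : 0 < M * p := Nat.mul_pos (by omega) hp
  have hbound := hC (latticeFreqs d (M * p) p) ((2 * d + 3) * ((M * p : ℕ) : ℝ) ^ (2 * d + 4))
    (Metric.ball 0 1 ∩ {x | x 0 < 0})
    ((pairwise_one_le_dist_latticeFreqs hm).imp fun _ _ => hb.trans)
    (fun ξ => norm_le_of_mem_thickening_latticeFreqs hm (Nat.le_mul_of_pos_left p (by omega))
      (by linarith [b.rOut_pos]))
    Set.inter_subset_left
    fun x hx => exists_phasesAligned_latticeFreqs le_rfl hp (mem_ball_zero_iff.1 hx.1).le hx.2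
  have hradius : 2 * Real.pi * ((2 * d + 3) * ((M * p : ℕ) : ℝ) ^ (2 * d + 4)) =
      W * (p : ℝ) ^ (2 * d + 4) := by
    rw [hW]
    push_cast
    ring
  rw [card_latticeFreqs hm, Nat.cast_pow, hradius] at hbound
  calc _ ≤ C * (1 + (W * (p : ℝ) ^ (2 * d + 4)) ^ 2) ^ s := hbound
    _ ≤ |C| * ((1 + W ^ 2) ^ s * (p : ℝ) ^ (2 * (2 * d + 4 : ℕ) * s)) := by
        gcongr
        · exact le_abs_self C
        · exact one_add_mul_pow_sq_rpow_le hs (by exact_mod_cast hp) W _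
    _ = |C| * (1 + W ^ 2) ^ s * (p : ℝ) ^ (2 * (2 * d + 4 : ℕ) * s) := (mul_assoc _ _ _).symm

lemma MaximalBounded.mono {s s' : ℝ} (hss : s ≤ s') (h : MaximalBounded n s) :
    MaximalBounded n s' := by
  obtain ⟨C, hC⟩ := h
  refine ⟨C, fun f => (hC f).trans ?_⟩
  gcongr
  exact sobolevNorm_mono hss _

lemma ConvergesAEOnSobolev.mono {s s' : ℝ} (hss : s ≤ s') (h : ConvergesAEOnSobolev n s) :
    ConvergesAEOnSobolev n s' :=
  fun f hf => h f ((sobolevNorm_mono hss f).trans_lt hf)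

lemma div_le_of_div_le_max_zero {s : ℝ} (hn : 1 ≤ n)
    (h : (n : ℝ) / (2 * ((n : ℝ) + 1)) ≤ max s 0) : (n : ℝ) / (2 * ((n : ℝ) + 1)) ≤ s := by
  have hpos : 0 < (n : ℝ) / (2 * ((n : ℝ) + 1)) := by
    have : (0 : ℝ) < n := by exact_mod_cast hn
    positivity
  exact (le_max_iff.1 h).resolve_right hpos.not_ge

theorem MaximalBounded.div_le {s : ℝ} (hn : 1 ≤ n) (h : MaximalBounded n s) :
    (n : ℝ) / (2 * ((n : ℝ) + 1)) ≤ s := by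
  refine div_le_of_div_le_max_zero hn ?_
  obtain ⟨d, rfl⟩ := Nat.exists_eq_add_of_le' hn
  obtain ⟨C, hC⟩ :=
    (h.mono (le_max_left s 0)).exists_pow_mul_volume_halfBall_le (le_max_right s 0)
  have hexp := exponent_le_of_pow_le_rpow (volume_real_halfBall_pos d) hC
  push_cast at hexp ⊢
  rw [div_le_iff₀ (by positivity)]
  linarith

theorem ConvergesAEOnSobolev.div_le {s : ℝ} (hn : 1 ≤ n) (h : ConvergesAEOnSobolev n s) :
    (n : ℝ) / (2 * ((n : ℝ) + 1)) ≤ s :=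
  div_le_of_div_le_max_zero hn <| MaximalBounded.div_le hn <|
    (h.mono (le_max_left s 0)).maximalBounded (le_max_right s 0)

end SchrodingerMaximal

end

theorem mainTheorem3 (n : ℕ) (hn : 1 ≤ n) (s : ℝ) :
    (SchrodingerMaximal.ConvergesAEOnSobolev n s → (n : ℝ) / (2 * ((n : ℝ) + 1)) ≤ s) ∧
    (SchrodingerMaximal.MaximalBounded n s → (n : ℝ) / (2 * ((n : ℝ) + 1)) ≤ s) ∧
    (SchrodingerMaximal.ConvergesAEOnSobolev n s ↔ SchrodingerMaximal.MaximalBounded n s) := by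
  have hpos : (0 : ℝ) ≤ (n : ℝ) / (2 * ((n : ℝ) + 1)) := by positivity
  exact ⟨SchrodingerMaximal.ConvergesAEOnSobolev.div_le hn,
    SchrodingerMaximal.MaximalBounded.div_le hn,
    fun h => h.maximalBounded (hpos.trans (h.div_le hn)),
    fun h => h.convergesAEOnSobolev (hpos.trans (h.div_le hn))⟩
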